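/- Consider a downlink network in the plane with the following data: intensities $\varphi_b,\varphi_u>0$ of base stations (BSs) and users, request rate $\lambda>0$ per user, slot duration $\tau>0$, transmission power $P>0$, path-loss exponent $\beta>2$, noise power $\sigma^2>0$, packet size $T>0$, bandwidth $B>0$, a library of $C$ packets with popularities $f_1\ge\dots\ge f_C\ge 0$, $\sum_i f_i=1$, a fraction $\alpha\in(0,1)$ of cache-enabled users, each caching packets $1,\dots,M$ ($M\le C$), and a mean number $\mathcal P>0$ of requests triggered per slot. Put $\delta=\sum_{i\le M}f_i$, $\bar\lambda=(1-\alpha\delta)\lambda$, $\mathcal P_{a1}=(1-\delta)\mathcal P$, $\mathcal P_{a2}=(1-\alpha)\delta\mathcal P$ and $\bar T=2^{T/(\tau B)}-1$. Let the number $N$ of users of a cell be Poisson of mean $\varphi_u s$ conditionally on the cell size $s$, where $s$ has density $\frac{(\varphi_bK)^K}{\Gamma(K)}s^{K-1}e^{-\varphi_bKs}$ on $(0,\infty)$, $K=3.575$. For $\bar\lambda\tau n<1$ let $\mathbb P_{0|n}=\lim_{k\to\infty}\mathbb P(q_k=0)$ for the queue $q_{k+1}=[q_k-1]^++a_{k+1}$,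 $q_0=0$, with i.i.d. Poisson arrivals $a_k$ of mean $\bar\lambda n\tau$. Put $p_t=\mathbb P(\bar\lambda\tau N\ge1)$, $p_0=\sum_{n:\,\bar\lambda\tau n<1}\mathbb P(N=n)\,\mathbb P_{0|n}$, and $\varphi_a=[p_t+(1-p_t)(1-p_0)]\varphi_b$. The BSs form a homogeneous Poisson point process of intensity $\varphi_b$, and the typical user, at the origin, is served by the nearest BS $b_0$, at distance $d_{0,0}$. Each BS is active independently with probability $\varphi_a/\varphi_b$ and, independently, has a packet to send, which is packet $j$ with probability proportional to the mean number of requests for $j$ served over the air, i.e. to $(1-\alpha)f_j$ if $j\le M$ and to $f_j$ if $j>M$; thus the active BSs sending uncached packets have intensity $\frac{\mathcal P_{a1}}{\mathcal P_{a1}+\mathcal P_{a2}}\varphi_a$. The channel power gains $|h_{k,0}|^2$ are i.i.d. exponential of mean $1$; positions, gains, activity and packets are independent. For a cache-enabled typical user that requests an uncached packet, the interference of BSs sending cached packets is cancelled, so $$\mathrm{SINR}_c=\frac{P|h_{0,0}|^2d_{0,0}^{-\beta}}{\sum_{j}P|h_{j,0}|^2d_{j,0}^{-\beta}+\sigma^2},$$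 where $j$ runs over the active BSs at distance $d_{j,0}>d_{0,0}$ that send an uncached packet. Then the packet loss rate $\mathcal P_{l,c}=\mathbb P\big(\tau B\log_2(1+\mathrm{SINR}_c)<T\big)$ is $$\mathcal P_{l,c}=1-2\pi\varphi_b\int_0^\infty r\exp\Big\{-r^\beta P^{-1}\bar T\sigma^2-\pi r^2\Big[\frac{\mathcal P_{a1}}{\mathcal P_{a1}+\mathcal P_{a2}}\varphi_aZ_1(\bar T)+\varphi_b\Big]\Big\}\,dr,$$ where $Z_1(\bar T)=\frac{2\bar T}{\beta-2}\,{}_2F_1\big[1,1-\tfrac2\beta;2-\tfrac2\beta;-\bar T\big]$ and ${}_2F_1$ is the Gauss hypergeometric function (analytically continued to $(-\infty,1)$). -/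

import Mathlib

open MeasureTheory ProbabilityTheory Filter Topology
open scoped ENNReal NNReal

namespace CacheNet

/-- The Euclidean plane. -/
abbrev Plane : Type := EuclideanSpace ℝ (Fin 2)

/-! ### The Gauss hypergeometric function on `(-∞, 1)` -/

/-- The Gauss hypergeometric function `₂F₁[a, b; c; z]` for `0 < b`, `b < c` and real `z < 1`, given
by Euler's integral. On `|z| < 1` this is the sum of the hypergeometric series, and it is the
analytic continuation of that sum to `z < 1`; Mathlib's `₂F₁` has the junk value of a divergent
series for `z < -1`. -/
noncomputable def gaussHypergeometric (a b c z : ℝ) : ℝ :=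
  Real.Gamma c / (Real.Gamma b * Real.Gamma (c - b)) *
    ∫ t in (0 : ℝ)..1, t ^ (b - 1) * (1 - t) ^ (c - b - 1) * (1 - z * t) ^ (-a)

/-- Inside the unit disc Euler's integral is the hypergeometric series. -/
theorem gaussHypergeometric_eq (b z : ℝ) (hb : 0 < b) (hz : |z| < 1) :
    gaussHypergeometric 1 b (b + 1) z = ordinaryHypergeometric (1 : ℝ) b (b + 1) z := by
  have hasc : ∀ n : ℕ, (ascPochhammer ℝ n).eval b * ((ascPochhammer ℝ n).eval (b + 1))⁻¹
      = b / (b + n) := by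
    intro n
    have h1 : (ascPochhammer ℝ n).eval (b + 1) * b = (ascPochhammer ℝ n).eval b * (b + n) := by
      have h2 := ascPochhammer_succ_eval (S := ℝ) n b
      rw [← h2, ascPochhammer_succ_left]
      simp [mul_comm]
    have h3 : 0 < (ascPochhammer ℝ n).eval (b + 1) := ascPochhammer_pos n _ (by linarith)
    have h4 : 0 < b + n := by positivity
    field_simp
    linarith
  have hser : ordinaryHypergeometric (1 : ℝ) b (b + 1) z = ∑' n : ℕ, b / (b + n) * z ^ n := by
    rw [ordinaryHypergeometric_eq_tsum]
    refine tsum_congr fun n => ?_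
    have : ((n.factorial : ℝ)) ≠ 0 := by positivity
    rw [ascPochhammer_eval_one, inv_mul_cancel₀ this, one_mul, hasc, smul_eq_mul]
  have hint : HasSum (fun n : ℕ => ∫ t in (0 : ℝ)..1, t ^ (b - 1) * (z * t) ^ n)
      (∫ t in (0 : ℝ)..1, t ^ (b - 1) * (1 - z * t)⁻¹) := by
    refine intervalIntegral.hasSum_integral_of_dominated_convergence
      (F := fun (n : ℕ) (t : ℝ) => t ^ (b - 1) * (z * t) ^ n)
      (fun (n : ℕ) (t : ℝ) => t ^ (b - 1) * |z| ^ n) ?_ ?_ ?_ ?_ ?_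
    · intro n
      exact (by fun_prop : Measurable fun t : ℝ => t ^ (b - 1) * (z * t) ^ n).aestronglyMeasurable
    · intro n
      refine ae_of_all _ fun t ht => ?_
      rw [Set.uIoc_of_le zero_le_one] at ht
      rw [norm_mul, norm_pow, norm_mul, Real.norm_of_nonneg (Real.rpow_nonneg ht.1.le _),
        Real.norm_eq_abs, Real.norm_of_nonneg ht.1.le]
      have := Real.rpow_nonneg ht.1.le (b - 1)
      have h0 : |z| * t ≤ |z| := by nlinarith [abs_nonneg z, ht.2]
      have := ht.1
      gcongr
    · exact ae_of_all _ fun t _ => (summable_geometric_of_lt_one (abs_nonneg z) hz).mul_left _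
    · simp only [tsum_mul_left]
      exact (intervalIntegral.intervalIntegrable_rpow' (by linarith)).mul_const _
    · refine ae_of_all _ fun t ht => ?_
      rw [Set.uIoc_of_le zero_le_one] at ht
      refine HasSum.mul_left _ (hasSum_geometric_of_norm_lt_one (ξ := z * t) ?_)
      rw [norm_mul, Real.norm_eq_abs, Real.norm_of_nonneg ht.1.le]
      nlinarith [abs_nonneg z, ht.1, ht.2]
  have hterm : ∀ n : ℕ, ∫ t in (0 : ℝ)..1, t ^ (b - 1) * (z * t) ^ n = z ^ n / (b + n) := by
    intro n
    have : ∫ t in (0 : ℝ)..1, t ^ (b - 1) * (z * t) ^ n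
        = ∫ t in (0 : ℝ)..1, z ^ n * t ^ (b - 1 + n) := by
      refine intervalIntegral.integral_congr_ae (ae_of_all _ fun t ht => ?_)
      rw [Set.uIoc_of_le zero_le_one] at ht
      rw [Real.rpow_add ht.1, Real.rpow_natCast, mul_pow]
      ring
    have hn : (0 : ℝ) ≤ n := n.cast_nonneg
    rw [this, intervalIntegral.integral_const_mul, integral_rpow (Or.inl (by linarith))]
    have h5 : b - 1 + (n : ℝ) + 1 = b + n := by ring
    rw [h5, Real.one_rpow, Real.zero_rpow (by positivity)]
    ring
  have hG := Real.Gamma_add_one hb.ne'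
  have hG0 := Real.Gamma_pos_of_pos hb
  unfold gaussHypergeometric
  simp only [add_sub_cancel_left, sub_self, Real.rpow_zero, mul_one, Real.rpow_neg_one,
    Real.Gamma_one]
  rw [hser, hG, mul_div_cancel_right₀ _ hG0.ne', ← hint.tsum_eq, ← tsum_mul_left]
  refine tsum_congr fun n => ?_
  rw [hterm]
  ring

/-- `Z₁(x) = 2x/(β-2) · ₂F₁[1, 1-2/β; 2-2/β; -x]`. -/
noncomputable def zOne (β x : ℝ) : ℝ :=
  2 * x / (β - 2) * gaussHypergeometric 1 (1 - 2 / β) (2 - 2 / β) (-x)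

/-! ### The queue of a base station -/

/-- The law of the number of queued requests after `k` slots, `q_{k+1} = [q_k - 1]⁺ + a_{k+1}`, where
the numbers of arrivals `a_{k+1}` are independent Poisson variables of mean `r`, started with an
empty buffer. Natural-number subtraction is the positive part. -/
noncomputable def queueLaw (r : ℝ≥0) : ℕ → Measure ℕ
  | 0 => Measure.dirac 0
  | k + 1 => (queueLaw r k).bind fun q => (poissonMeasure r).map fun a => (q - 1) + a

/-- The probability that the queue in the limit `k → ∞` is empty. -/
noncomputable def emptyQueueProb (r : ℝ≥0) : ℝ :=
  limUnder atTop fun k => (queueLaw r k).real {0}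

theorem queueLaw_isProbabilityMeasure (r : ℝ≥0) (k : ℕ) : IsProbabilityMeasure (queueLaw r k) := by
  induction k with
  | zero => exact (inferInstance : IsProbabilityMeasure (Measure.dirac (0 : ℕ)))
  | succ k ih =>
    rw [queueLaw]
    refine isProbabilityMeasure_bind (Measurable.of_discrete).aemeasurable (ae_of_all _ fun q => ?_)
    exact Measure.isProbabilityMeasure_map Measurable.of_discrete.aemeasurable

theorem queueLaw_lintegral_antitone (r : ℝ≥0) (k : ℕ) (g : ℕ → ℝ≥0∞) (hg : Antitone g) :
    ∫⁻ q, g q ∂(queueLaw r (k + 1)) ≤ ∫⁻ q, g q ∂(queueLaw r k) := by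
  have hstep : ∀ (k : ℕ) (g : ℕ → ℝ≥0∞), ∫⁻ q, g q ∂(queueLaw r (k + 1)) =
      ∫⁻ q, (∫⁻ a, g ((q - 1) + a) ∂(poissonMeasure r)) ∂(queueLaw r k) := by
    intro k g
    rw [queueLaw, Measure.lintegral_bind (Measurable.of_discrete).aemeasurable
      (Measurable.of_discrete).aemeasurable]
    refine lintegral_congr fun q => ?_
    rw [lintegral_map Measurable.of_discrete Measurable.of_discrete]
  induction k generalizing g with
  | zero =>
    have := queueLaw_isProbabilityMeasure r 1
    calc ∫⁻ q, g q ∂(queueLaw r 1) ≤ ∫⁻ _, g 0 ∂(queueLaw r 1) :=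
          lintegral_mono fun q => hg (Nat.zero_le q)
      _ = ∫⁻ q, g q ∂(queueLaw r 0) := by rw [lintegral_const, measure_univ, mul_one]; simp [queueLaw]
  | succ k ih =>
    rw [hstep (k + 1) g, hstep k g]
    refine ih (fun q => ∫⁻ a, g ((q - 1) + a) ∂(poissonMeasure r)) fun q q' h =>
      lintegral_mono fun a => hg ?_
    omega

/-- The limit in the definition of `emptyQueueProb` exists. -/
theorem tendsto_emptyQueueProb (r : ℝ≥0) :
    Tendsto (fun k => (queueLaw r k).real {0}) atTop (𝓝 (emptyQueueProb r)) := by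
  have hprob := queueLaw_isProbabilityMeasure r
  have hanti : Antitone fun k => (queueLaw r k).real {0} := by
    refine antitone_nat_of_succ_le fun k => ?_
    have hg : Antitone (Set.indicator ({0} : Set ℕ) (1 : ℕ → ℝ≥0∞)) := by
      intro a b hab
      by_cases hb : b = 0
      · have : a = 0 := by omega
        simp [hb, this]
      · simp [hb]
    have h := queueLaw_lintegral_antitone r k _ hg
    rw [lintegral_indicator_one (measurableSet_singleton 0),
      lintegral_indicator_one (measurableSet_singleton 0)] at h
    exact ENNReal.toReal_mono (measure_ne_top _ _) h
  refine tendsto_nhds_limUnder ⟨_, tendsto_atTop_ciInf hanti ⟨0, ?_⟩⟩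
  rintro _ ⟨k, rfl⟩
  exact measureReal_nonneg

/-! ### Parameters of the network -/

/-- The parameters of the network together with their standing ranges. -/
structure Params where
  /-- intensity of the base stations -/
  φb : ℝ
  /-- intensity of the users -/
  φu : ℝ
  /-- request rate of a user -/
  lam : ℝ
  /-- slot duration -/
  τ : ℝ
  /-- transmission power -/
  P : ℝ
  /-- path-loss exponent -/
  β : ℝ
  /-- noise power `σ²` -/
  noise : ℝ
  /-- packet size -/
  T : ℝ
  /-- bandwidth -/
  B : ℝ
  /-- fraction of cache-enabled users -/
  α : ℝ
  /-- mean number of requests triggered by the users in a slot -/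
  req : ℝ
  /-- number of packets in the library -/
  C : ℕ
  /-- number of packets cached at a cache-enabled user -/
  M : ℕ
  /-- packet popularities, in decreasing order -/
  f : Fin C → ℝ
  φb_pos : 0 < φb
  φu_pos : 0 < φu
  lam_pos : 0 < lam
  τ_pos : 0 < τ
  P_pos : 0 < P
  two_lt_β : 2 < β
  noise_pos : 0 < noise
  T_pos : 0 < T
  B_pos : 0 < B
  α_pos : 0 < α
  α_lt_one : α < 1
  req_pos : 0 < req
  M_le_C : M ≤ C
  f_nonneg : ∀ j, 0 ≤ f j
  f_antitone : Antitone f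
  f_sum : ∑ j, f j = 1

theorem measurable_poissonMeasure_comp (c : ℝ) :
    Measurable fun s : ℝ => poissonMeasure (c * s).toNNReal := by
  refine Measure.measurable_of_measurable_coe _ fun A hA => ?_
  simp only [poissonMeasure, Measure.sum_apply _ hA, Measure.smul_apply, smul_eq_mul]
  refine Measurable.tsum fun n => ?_
  fun_prop

namespace Params

variable (N : Params)

/-- The cached packets: the `M` most popular ones. -/
def cached : Finset (Fin N.C) := Finset.univ.filter fun j => (j : ℕ) < N.M

/-- The cache hit ratio `δ`. -/
noncomputable def hit : ℝ := ∑ j ∈ N.cached, N.f j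

/-- `λ̄ = (1 - αδ)λ`: the rate at which one user generates requests to its base station. -/
noncomputable def rate : ℝ := (1 - N.α * N.hit) * N.lam

/-- The law of the number of users of a cell: conditionally on the cell size `s` it is Poisson of
mean `φ_u s`, and the cell size has the Gamma density of shape `K = 3.575` and rate `φ_b K`. -/
noncomputable def userLaw : Measure ℕ :=
  (gammaMeasure 3.575 (N.φb * 3.575)).bind fun s => poissonMeasure (N.φu * s).toNNReal

theorem userLaw_isProbabilityMeasure (N : Params) : IsProbabilityMeasure N.userLaw := by
  have h := isProbabilityMeasure_gammaMeasure (a := 3.575) (r := N.φb * 3.575) (by norm_num)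
    (by have := N.φb_pos; positivity)
  exact isProbabilityMeasure_bind (measurable_poissonMeasure_comp _).aemeasurable
    (ae_of_all _ fun s => inferInstance)

/-- The probability `p_t` of a full-load cell, `λ̄ τ n ≥ 1`. -/
noncomputable def pFull : ℝ := N.userLaw.real {n | 1 ≤ N.rate * N.τ * n}

open Classical in
/-- The probability `p₀` of a free-load cell: `λ̄ τ n < 1`, and the queue, which receives a Poisson
number of requests of mean `λ̄ n τ` per slot, is empty in equilibrium. -/
noncomputable def pFree : ℝ :=
  ∑' n : ℕ, if N.rate * N.τ * n < 1 then
    N.userLaw.real {n} * emptyQueueProb (N.rate * N.τ * n).toNNReal else 0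

/-- The probability with which a base station is retained as an active one. -/
noncomputable def pActive : ℝ := N.pFull + (1 - N.pFull) * (1 - N.pFree)

/-- The intensity `φ_a` of the active base stations. -/
noncomputable def φa : ℝ := N.pActive * N.φb

/-- The mean number of requests for packet `j` in a slot that have to be served by base stations: all
of them, except those of cache-enabled users if the packet is cached. -/
noncomputable def airReq (j : Fin N.C) : ℝ :=
  if j ∈ N.cached then (1 - N.α) * N.f j * N.req else N.f j * N.req

/-- The mean number of requests for uncached packets served by base stations, `(1 - δ)𝒫`. -/
noncomputable def Pa1 : ℝ := (1 - N.hit) * N.req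

/-- The mean number of requests for cached packets served by base stations, `(1 - α)δ𝒫`. -/
noncomputable def Pa2 : ℝ := (1 - N.α) * N.hit * N.req

/-- The decoding threshold `T̄ = 2^(T/(τB)) - 1`. -/
noncomputable def threshold : ℝ := (2 : ℝ) ^ (N.T / (N.τ * N.B)) - 1

end Params

/-! ### The Poisson point process and the signals -/

/-- The (almost surely distinct, infinitely many) points `X 0, X 1, …` form a Poisson point process
with intensity measure `ν`: the numbers of points in sets of finite measure are Poisson, and those in
disjoint sets are independent. -/
structure IsPoissonProcess {Ω E : Type*} [MeasurableSpace Ω] [MeasurableSpace E]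
    (μ : Measure Ω) (ν : Measure E) (X : ℕ → Ω → E) : Prop where
  measurable : ∀ i, Measurable (X i)
  count_law : ∀ A : Set E, MeasurableSet A → ν A ≠ ∞ → ∀ k : ℕ,
    μ {ω | {i | X i ω ∈ A}.encard = k} = poissonMeasure (ν A).toNNReal {k}
  count_indep : ∀ (m : ℕ) (A : Fin m → Set E), (∀ l, MeasurableSet (A l)) →
    (∀ l, ν (A l) ≠ ∞) → Pairwise (fun l l' => Disjoint (A l) (A l')) →
    iIndepFun (fun l ω => {i | X i ω ∈ A l}.encard) μ

/-- The base stations, in an arbitrary enumeration, as seen by a typical user at the origin. -/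
structure BaseStations (Ω : Type*) (N : Params) where
  /-- position -/
  loc : ℕ → Ω → Plane
  /-- power gain `|h|²` of the channel to the user -/
  gain : ℕ → Ω → ℝ
  /-- whether the base station is retained as an active one in the slot -/
  active : ℕ → Ω → Bool
  /-- the packet that the base station transmits if it is active -/
  packet : ℕ → Ω → Fin N.C

/-- The stochastic model: the base stations form a homogeneous Poisson process of intensity `φ_b`;
the channels are Rayleigh fading of unit mean power; the active ones are an independent thinning, and
so are those that send a given packet, in proportion to the requests served by base stations. -/
structure IsNetwork {Ω : Type*} [MeasurableSpace Ω] (N : Params) (μ : Measure Ω)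
    (S : BaseStations Ω N) : Prop where
  loc_poisson : IsPoissonProcess μ (ENNReal.ofReal N.φb • (volume : Measure Plane)) S.loc
  gain_measurable : ∀ i, Measurable (S.gain i)
  gain_law : ∀ i, μ.map (S.gain i) = expMeasure 1
  gain_indep : iIndepFun S.gain μ
  active_measurable : ∀ i, Measurable (S.active i)
  active_law : ∀ i, μ.real {ω | S.active i ω = true} = N.pActive
  active_indep : iIndepFun S.active μ
  packet_measurable : ∀ i, Measurable (S.packet i)
  packet_law : ∀ i j, μ.real {ω | S.packet i ω = j} = N.airReq j / ∑ j', N.airReq j'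
  packet_indep : iIndepFun S.packet μ
  indep_loc : IndepFun (fun ω i => S.loc i ω)
    (fun ω => ((fun i => S.gain i ω), (fun i => S.active i ω), (fun i => S.packet i ω))) μ
  indep_gain : IndepFun (fun ω i => S.gain i ω)
    (fun ω => ((fun i => S.active i ω), (fun i => S.packet i ω))) μ
  indep_active : IndepFun (fun ω i => S.active i ω) (fun ω i => S.packet i ω) μ

namespace BaseStations

variable {Ω : Type*} {N : Params} (S : BaseStations Ω N)

/-- The serving base station of the user at the origin: the nearest one. -/
noncomputable def serving (ω : Ω) : ℕ := sInf {i | ∀ j, ‖S.loc i ω‖ ≤ ‖S.loc j ω‖}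

/-- The distance `d₀₀` to the serving base station. -/
noncomputable def servingDist (ω : Ω) : ℝ := ‖S.loc (S.serving ω) ω‖

/-- The active base stations outside the disc of radius `d₀₀` whose packet is not cached at the
user; the interference of the other ones is cancelled. -/
def uncancelled (ω : Ω) : Set ℕ :=
  {i | S.servingDist ω < ‖S.loc i ω‖ ∧ S.active i ω = true ∧ S.packet i ω ∉ N.cached}

/-- The cumulative interference `I_c` after cancellation. -/
noncomputable def interference (ω : Ω) : ℝ≥0∞ :=
  ∑' i : S.uncancelled ω, ENNReal.ofReal (N.P * S.gain i ω * ‖S.loc i ω‖ ^ (-N.β))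

/-- The signal-to-interference-plus-noise ratio `SINR_c` of a cache-enabled user that requests an
uncached packet. -/
noncomputable def sinr (ω : Ω) : ℝ≥0∞ :=
  ENNReal.ofReal (N.P * S.gain (S.serving ω) ω * S.servingDist ω ^ (-N.β)) /
    (S.interference ω + ENNReal.ofReal N.noise)

/-- The packet loss rate: the probability that the packet is not transmitted completely in its slot.
The value of `sinr` is finite as the noise power is positive. -/
noncomputable def lossRate [MeasurableSpace Ω] (μ : Measure Ω) : ℝ :=
  μ.real {ω | N.τ * N.B * Real.logb 2 (1 + (S.sinr ω).toReal) < N.T}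

end BaseStations

end CacheNet

/-!
The packet is received exactly when the gain of the serving channel is at least `θ + ∑ cᵢ |hᵢ|²`,
the sum over the uncancelled interferers, where `d` is the serving distance, `θ = d ^ β P⁻¹ T̄ σ²`
and `cᵢ = T̄ (‖xᵢ‖ / d) ^ (-β)` (`covered_iff`). Given the positions of the base stations, the
gain is exponential and independent of the sum, so the conditional coverage probability is
`exp (-θ)` times a product, over the base stations outside the serving disc, of the factors
`1 - p + p / (1 + cᵢ)`, with `p` the probability that a base station is active and sends an
uncached packet (`measure_interference_le`, `IsNetwork.measure_covered`).

The Poisson process enters through its generating functional `𝔼 ∏ g (Xᵢ) = exp (-∫ (1 - g) dν)`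
(`IsPoissonProcess.lintegral_infProd`), which follows from the law of the counts for functions
with finitely many values and by monotone limits in general. Conditioning on the nearest point is
avoided: for `0 < a < b`, the coverage probability with serving distance in `(a, b]` lies between
multiples of differences of generating functionals of functions that vanish on the disc of radius
`a`, are constant on the annulus, and have their interference factors scaled by `b` or by `a`
outside it (`le_coverageIoc`, `coverageIoc_le`). The two bounds agree to first order in `b - a`, so
they give the right derivative in `b`, and the coverage probability is an integral over the
serving distance (`lintegral_coverage`).

The interference contributes to that integral the exponential of minus the integral of `φ_b (1 - g)`
outside the disc of radius `r`, with `g` the interference factor. This integral scales like `r²`, and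
in polar coordinates the substitution `t = x ^ (-β)` turns it into Euler's integral for the
hypergeometric function (`zOne_eq_integral`, `Params.hasExponent`).
-/

namespace CacheNet

/-! ### Infinite products of factors in the unit interval -/

/-- The infinite product of a sequence of factors in `[0, 1]`, as the infimum of its partial
products. Unlike `∏'` it needs no convergence hypothesis. -/
noncomputable def infProd (u : ℕ → ℝ≥0∞) : ℝ≥0∞ := ⨅ n, ∏ i ∈ Finset.range n, u i

theorem infProd_mono {u v : ℕ → ℝ≥0∞} (h : ∀ i, u i ≤ v i) : infProd u ≤ infProd v :=
  iInf_mono fun _ => Finset.prod_le_prod' fun i _ => h i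

theorem infProd_le_one (u : ℕ → ℝ≥0∞) : infProd u ≤ 1 :=
  (iInf_le _ 0).trans (by simp)

theorem infProd_eq_zero {u : ℕ → ℝ≥0∞} (i : ℕ) (h : u i = 0) : infProd u = 0 :=
  le_antisymm ((iInf_le _ (i + 1)).trans
    (Finset.prod_eq_zero (Finset.mem_range.2 i.lt_succ_self) h).le) zero_le

theorem antitone_prod_range {u : ℕ → ℝ≥0∞} (h : ∀ i, u i ≤ 1) :
    Antitone fun n => ∏ i ∈ Finset.range n, u i :=
  antitone_nat_of_succ_le fun n => by
    rw [Finset.prod_range_succ]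
    exact mul_le_of_le_one_right' (h n)

theorem tendsto_infProd {u : ℕ → ℝ≥0∞} (h : ∀ i, u i ≤ 1) :
    Tendsto (fun n => ∏ i ∈ Finset.range n, u i) atTop (𝓝 (infProd u)) :=
  tendsto_atTop_iInf (antitone_prod_range h)

theorem infProd_finset_prod {ι : Type*} (s : Finset ι) (U : ι → ℕ → ℝ≥0∞)
    (h : ∀ l i, U l i ≤ 1) :
    infProd (fun i => ∏ l ∈ s, U l i) = ∏ l ∈ s, infProd (U l) := by
  refine tendsto_nhds_unique
    (tendsto_infProd fun i => Finset.prod_le_one' fun l _ => h l i) ?_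
  simp_rw [Finset.prod_comm (s := Finset.range _)]
  exact ENNReal.tendsto_finsetProd_of_ne_top _ (fun l _ => tendsto_infProd (h l))
    fun l _ => ((infProd_le_one _).trans_lt ENNReal.one_lt_top).ne

theorem infProd_iInf {U : ℕ → ℕ → ℝ≥0∞} (h : ∀ k i, U k i ≤ 1)
    (hU : ∀ i, Antitone fun k => U k i) :
    infProd (fun i => ⨅ k, U k i) = ⨅ k, infProd (U k) := by
  unfold infProd
  rw [iInf_comm]
  refine iInf_congr fun _ => ?_
  refine tendsto_nhds_unique (ENNReal.tendsto_finsetProd_of_ne_top (Finset.range _)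
    (fun i _ => tendsto_atTop_iInf (hU i))
    fun i _ => ((iInf_le _ 0).trans_lt ((h 0 i).trans_lt ENNReal.one_lt_top)).ne) ?_
  exact tendsto_atTop_iInf fun a b hab => Finset.prod_le_prod' fun i _ => hU i hab

theorem measurable_infProd {α : Type*} [MeasurableSpace α] {u : ℕ → α → ℝ≥0∞}
    (h : ∀ i, Measurable (u i)) : Measurable fun a => infProd fun i => u i a :=
  Measurable.iInf fun _ => Finset.measurable_fun_prod _ fun i _ => h i

/-- If one factor equals `v` where the other product has the factor `1`, and the remaining factors
compare, then the whole product gains the factor `v`. -/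
theorem infProd_le_mul_infProd {u u' : ℕ → ℝ≥0∞} {v : ℝ≥0∞} (hu : ∀ i, u i ≤ 1)
    (hu' : ∀ i, u' i ≤ 1) (hv : v ≠ ∞) (i₀ : ℕ) (h₀ : u i₀ = v) (h₀' : u' i₀ = 1)
    (h : ∀ i, i ≠ i₀ → u i ≤ u' i) : infProd u ≤ v * infProd u' := by
  refine le_of_tendsto_of_tendsto (tendsto_infProd hu)
    (ENNReal.Tendsto.const_mul (tendsto_infProd hu') (Or.inr hv)) ?_
  filter_upwards [eventually_gt_atTop i₀] with n hn
  have hm : i₀ ∈ Finset.range n := Finset.mem_range.2 hn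
  rw [← Finset.mul_prod_erase _ _ hm, ← Finset.mul_prod_erase _ u' hm, h₀, h₀', one_mul]
  gcongr with i hi
  exact h i (Finset.ne_of_mem_erase hi)

/-- The power `c ^ m` with an exponent in `ℕ∞`, for a base `c ≤ 1`. -/
noncomputable def powENat (c : ℝ≥0∞) (m : ℕ∞) : ℝ≥0∞ := ⨅ (k : ℕ) (_ : (k : ℕ∞) ≤ m), c ^ k

theorem powENat_natCast {c : ℝ≥0∞} (hc : c ≤ 1) (m : ℕ) : powENat c m = c ^ m := by
  refine le_antisymm (iInf₂_le (κ := fun k : ℕ => (k : ℕ∞) ≤ m) (f := fun k _ => c ^ k) m le_rfl)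
    (le_iInf₂ fun k hk => ?_)
  exact pow_le_pow_right_of_le_one' hc (by exact_mod_cast hk)

open Classical in
/-- A product of equal factors over a set of indices depends only on the number of indices, also if
the set is infinite. -/
theorem infProd_ite (J : Set ℕ) {c : ℝ≥0∞} (hc : c ≤ 1) :
    infProd (fun i => if i ∈ J then c else 1) = powENat c J.encard := by
  have hprod : ∀ n, (∏ i ∈ Finset.range n, if i ∈ J then c else 1)
      = c ^ ((Finset.range n).filter (· ∈ J)).card := by
    intro n
    rw [Finset.prod_ite, Finset.prod_const, Finset.prod_const_one, mul_one]
  unfold infProd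
  simp_rw [hprod]
  refine le_antisymm (le_iInf₂ fun k hk => ?_) (le_iInf fun n => iInf₂_le _ ?_)
  · obtain ⟨t, htJ, htk⟩ := Set.exists_subset_encard_eq hk
    have hfin : t.Finite := Set.finite_of_encard_eq_coe htk
    obtain ⟨n, hn⟩ := hfin.bddAbove
    refine (iInf_le _ (n + 1)).trans (pow_le_pow_right_of_le_one' hc ?_)
    have h1 : hfin.toFinset.card = k := by
      rw [hfin.encard_eq_coe_toFinset_card] at htk
      exact_mod_cast htk
    rw [← h1]
    refine Finset.card_le_card fun i hi => ?_
    have hi' := hfin.mem_toFinset.1 hi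
    exact Finset.mem_filter.2 ⟨Finset.mem_range.2 (Nat.lt_succ_of_le (hn hi')), htJ hi'⟩
  · rw [← Set.encard_coe_eq_coe_finsetCard]
    refine Set.encard_le_encard fun i hi => ?_
    simpa using (Finset.mem_filter.1 (Finset.mem_coe.1 hi)).2

/-! ### The probability generating functional of a Poisson process -/

section

theorem lintegral_pow_poissonMeasure (r : ℝ≥0) {c : ℝ≥0∞} (hc : c ≤ 1) :
    ∫⁻ k, c ^ k ∂(poissonMeasure r) = ENNReal.ofReal (Real.exp (-(r * (1 - c).toReal))) := by
  lift c to ℝ≥0 using (hc.trans_lt ENNReal.one_lt_top).ne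
  have hc' : c ≤ 1 := by exact_mod_cast hc
  have h1 : ((1 : ℝ≥0∞) - c).toReal = 1 - c := by
    rw [ENNReal.toReal_sub_of_le hc (by simp)]; simp
  rw [poissonMeasure, lintegral_sum_measure]
  simp_rw [lintegral_smul_measure, lintegral_dirac, smul_eq_mul]
  have hs : HasSum (fun n : ℕ => Real.exp (-r) * ((r * c : ℝ) ^ n / n.factorial))
      (Real.exp (-r) * Real.exp (r * c)) := by
    refine HasSum.mul_left _ ?_
    rw [Real.exp_eq_exp_ℝ]
    exact NormedSpace.expSeries_div_hasSum_exp (r * c : ℝ)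
  rw [h1, show -((r : ℝ) * (1 - c)) = -r + r * c by ring, Real.exp_add, ← hs.tsum_eq,
    ENNReal.ofReal_tsum_of_nonneg (fun n => by positivity) hs.summable]
  refine tsum_congr fun n => ?_
  rw [← ENNReal.ofReal_coe_nnreal (p := c), ← ENNReal.ofReal_pow c.coe_nonneg,
    ← ENNReal.ofReal_mul (by positivity)]
  congr 1
  rw [mul_pow]; ring

variable {Ω E : Type*} [MeasurableSpace Ω] [MeasurableSpace E] {μ : Measure Ω}
  {ν : Measure E} {X : ℕ → Ω → E}

theorem measurable_encard (hX : ∀ i, Measurable (X i)) {A : Set E} (hA : MeasurableSet A) :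
    Measurable fun ω => {i | X i ω ∈ A}.encard := by
  have h : Measurable fun ω => (({i | X i ω ∈ A}.encard : ℕ∞) : ℝ≥0∞) := by
    have h1 : ∀ ω, (({i | X i ω ∈ A}.encard : ℕ∞) : ℝ≥0∞)
        = ∑' i, A.indicator (fun _ => 1) (X i ω) := fun ω => by
      rw [← ENNReal.tsum_set_one, tsum_subtype {i | X i ω ∈ A} fun _ => (1 : ℝ≥0∞)]
      rfl
    simp_rw [h1]
    exact Measurable.tsum fun i => (measurable_const.indicator hA).comp (hX i)
  refine measurable_to_countable' fun m => ?_
  have : (fun ω => {i | X i ω ∈ A}.encard) ⁻¹' {m}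
      = (fun ω => (({i | X i ω ∈ A}.encard : ℕ∞) : ℝ≥0∞)) ⁻¹' {(m : ℝ≥0∞)} := by
    ext ω; simp
  rw [this]
  exact h (measurableSet_singleton _)

namespace IsPoissonProcess

variable [IsProbabilityMeasure μ]

theorem map_encard (hX : IsPoissonProcess μ ν X) {A : Set E} (hA : MeasurableSet A)
    (hν : ν A ≠ ∞) :
    μ.map (fun ω => {i | X i ω ∈ A}.encard)
      = (poissonMeasure (ν A).toNNReal).map (Nat.cast : ℕ → ℕ∞) := by
  have hm := measurable_encard hX.measurable hA
  have hfin : ∀ k : ℕ, μ.map (fun ω => {i | X i ω ∈ A}.encard) {(k : ℕ∞)}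
      = (poissonMeasure (ν A).toNNReal).map (Nat.cast : ℕ → ℕ∞) {(k : ℕ∞)} := by
    intro k
    rw [Measure.map_apply hm (measurableSet_singleton _),
      Measure.map_apply Measurable.of_discrete (measurableSet_singleton _)]
    have hk : (Nat.cast : ℕ → ℕ∞) ⁻¹' {(k : ℕ∞)} = {k} := by ext n; simp
    rw [hk, ← hX.count_law A hA hν k]
    rfl
  have := Measure.isProbabilityMeasure_map (μ := μ) hm.aemeasurable
  have := Measure.isProbabilityMeasure_map (μ := poissonMeasure (ν A).toNNReal)
    (f := (Nat.cast : ℕ → ℕ∞)) Measurable.of_discrete.aemeasurable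
  have hr : ({⊤} : Set ℕ∞) = (⋃ k : ℕ, {(k : ℕ∞)})ᶜ := by
    ext m; induction m <;> simp
  refine Measure.ext_of_singleton fun m => ?_
  induction m with
  | coe k => exact hfin k
  | top =>
    rw [hr, prob_compl_eq_one_sub (MeasurableSet.of_discrete),
      prob_compl_eq_one_sub (MeasurableSet.of_discrete)]
    congr 1
    have hd : Pairwise (Function.onFun Disjoint fun k : ℕ => ({(k : ℕ∞)} : Set ℕ∞)) :=
      fun a b hab => by simpa [Function.onFun] using hab
    rw [measure_iUnion hd fun _ => MeasurableSet.of_discrete,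
      measure_iUnion hd fun _ => MeasurableSet.of_discrete]
    exact tsum_congr hfin

theorem ae_finite (hX : IsPoissonProcess μ ν X) {A : Set E} (hA : MeasurableSet A)
    (hν : ν A ≠ ∞) : ∀ᵐ ω ∂μ, {i | X i ω ∈ A}.Finite := by
  have hm := measurable_encard hX.measurable hA
  have h : μ ((fun ω => {i | X i ω ∈ A}.encard) ⁻¹' {⊤}) = 0 := by
    rw [← Measure.map_apply hm (measurableSet_singleton _), hX.map_encard hA hν,
      Measure.map_apply Measurable.of_discrete (measurableSet_singleton _)]
    convert measure_empty (μ := poissonMeasure (ν A).toNNReal)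
    ext n; simp
  rw [ae_iff]
  convert h using 2
  ext ω
  exact Set.encard_eq_top_iff.symm

theorem lintegral_powENat (hX : IsPoissonProcess μ ν X) {A : Set E} (hA : MeasurableSet A)
    (hν : ν A ≠ ∞) {c : ℝ≥0∞} (hc : c ≤ 1) :
    ∫⁻ ω, powENat c {i | X i ω ∈ A}.encard ∂μ
      = ENNReal.ofReal (Real.exp (-((ν A).toReal * (1 - c).toReal))) := by
  have h := lintegral_map (μ := μ) (f := powENat c) Measurable.of_discrete
    (measurable_encard hX.measurable hA)
  rw [← h, hX.map_encard hA hν, lintegral_map Measurable.of_discrete Measurable.of_discrete]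
  simp_rw [powENat_natCast hc]
  exact lintegral_pow_poissonMeasure _ hc

open Classical in
/-- The generating functional at a function with finitely many values that is `1` outside a set of
finite measure. -/
theorem lintegral_infProd_prod_ite (hX : IsPoissonProcess μ ν X) {ι : Type*} (s : Finset ι)
    (A : ι → Set E) (c : ι → ℝ≥0∞) (hA : ∀ l, MeasurableSet (A l)) (hν : ∀ l ∈ s, ν (A l) ≠ ∞)
    (hd : Pairwise (Function.onFun Disjoint A)) (hc : ∀ l, c l ≤ 1) :
    ∫⁻ ω, infProd (fun i => ∏ l ∈ s, if X i ω ∈ A l then c l else 1) ∂μ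
      = ENNReal.ofReal (Real.exp (-∑ l ∈ s, (ν (A l)).toReal * (1 - c l).toReal)) := by
  have h1 : ∀ ω, infProd (fun i => ∏ l ∈ s, if X i ω ∈ A l then c l else 1)
      = ∏ l ∈ s, powENat (c l) {i | X i ω ∈ A l}.encard := by
    intro ω
    rw [infProd_finset_prod s (fun l i => if X i ω ∈ A l then c l else 1)
      fun l i => by split_ifs <;> simp [hc]]
    exact Finset.prod_congr rfl fun l _ => infProd_ite {i | X i ω ∈ A l} (hc l)
  simp_rw [h1]
  let e := s.equivFin.symm
  have hind := hX.count_indep s.card (fun l => A (e l)) (fun l => hA _)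
    (fun l => hν _ (e l).2) fun l l' hl => hd fun h => hl (e.injective (Subtype.ext h))
  have hind' : iIndepFun (fun l ω => powENat (c (e l)) {i | X i ω ∈ A (e l)}.encard) μ :=
    hind.comp (fun l => powENat (c (e l))) fun l => Measurable.of_discrete
  have h2 := lintegral_prod_eq_prod_lintegral_of_indepFun Finset.univ _ hind' fun l =>
    (Measurable.of_discrete (f := powENat (c (e l)))).comp (measurable_encard hX.measurable (hA _))
  have h3 : ∀ f : ι → ℝ≥0∞, ∏ l ∈ s, f l = ∏ l, f (e l) := by
    intro f
    rw [← Finset.prod_coe_sort, e.prod_comp fun l => f l]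
  simp_rw [h3 fun l => powENat (c l) {i | X i _ ∈ A l}.encard]
  rw [h2, ← h3 fun l => ∫⁻ ω, powENat (c l) {i | X i ω ∈ A l}.encard ∂μ, ← Finset.sum_neg_distrib,
    Real.exp_sum, ENNReal.ofReal_prod_of_nonneg fun l _ => (Real.exp_pos _).le]
  exact Finset.prod_congr rfl fun l hl => hX.lintegral_powENat (hA l) (hν l hl) (hc l)

/-- The probability generating functional of a Poisson process. -/
theorem lintegral_infProd (hX : IsPoissonProcess μ ν X) {g : E → ℝ≥0∞} (hg : Measurable g)
    (hg1 : ∀ y, g y ≤ 1) (hint : ∫⁻ y, (1 - g y) ∂ν ≠ ∞) :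
    ∫⁻ ω, infProd (fun i => g (X i ω)) ∂μ
      = ENNReal.ofReal (Real.exp (-(∫⁻ y, (1 - g y) ∂ν).toReal)) := by
  classical
  have hf : Measurable fun y => 1 - g y := measurable_const.sub hg
  -- Simple functions increase to `1 - g`; being integrable, they have support of finite measure.
  set f : ℕ → SimpleFunc E ℝ≥0∞ := SimpleFunc.eapprox fun y => 1 - g y with hfdef
  have hmono : Monotone f := SimpleFunc.monotone_eapprox _
  have hsup : ∀ y, ⨆ n, f n y = 1 - g y := fun y => SimpleFunc.iSup_eapprox_apply hf y
  have hle : ∀ n y, f n y ≤ 1 - g y := fun n y => (hsup y) ▸ le_iSup (fun n => f n y) n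
  have hle1 : ∀ n y, f n y ≤ 1 := fun n y => (hle n y).trans tsub_le_self
  have hginf : ∀ y, g y = ⨅ n, (1 - f n y) := by
    intro y
    rw [← ENNReal.sub_iSup ENNReal.one_ne_top, hsup,
      ENNReal.sub_sub_cancel ENNReal.one_ne_top (hg1 y)]
  have hanti : ∀ y, Antitone fun n => 1 - f n y := fun y a b hab =>
    tsub_le_tsub_left (hmono hab y) 1
  have h1 : ∀ ω, infProd (fun i => g (X i ω)) = ⨅ n, infProd fun i => 1 - f n (X i ω) := by
    intro ω
    simp_rw [hginf]
    exact infProd_iInf (fun _ _ => tsub_le_self) fun i => hanti _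
  have hmeas : ∀ n, Measurable fun ω => infProd fun i => 1 - f n (X i ω) := fun n =>
    measurable_infProd fun i => measurable_const.sub ((f n).measurable.comp (hX.measurable i))
  have hnu : ∀ n, ∀ c ≠ 0, ν (f n ⁻¹' {c}) ≠ ∞ := by
    intro n c hc htop
    refine hint (top_le_iff.1 ?_)
    calc ∞ = c * ν (f n ⁻¹' {c}) := by rw [htop, ENNReal.mul_top hc]
      _ = ∫⁻ y in f n ⁻¹' {c}, c ∂ν := by rw [setLIntegral_const]
      _ ≤ ∫⁻ y in f n ⁻¹' {c}, (1 - g y) ∂ν :=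
        setLIntegral_mono hf fun y hy => by
          rw [← show f n y = c from hy]; exact hle n y
      _ ≤ _ := setLIntegral_le_lintegral _ _
  have hn : ∀ n, ∫⁻ ω, infProd (fun i => 1 - f n (X i ω)) ∂μ
      = ENNReal.ofReal (Real.exp (-(∫⁻ y, f n y ∂ν).toReal)) := by
    intro n
    have hprod : ∀ y, 1 - f n y
        = ∏ c ∈ (f n).range.erase 0, if y ∈ f n ⁻¹' {c} then 1 - c else 1 := by
      intro y
      by_cases h0 : f n y = 0
      · rw [h0, Finset.prod_eq_one, tsub_zero]
        intro c hc
        rw [if_neg]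
        rintro (h : f n y = c)
        exact Finset.ne_of_mem_erase hc (h ▸ h0)
      · rw [Finset.prod_eq_single_of_mem (f n y)
          (Finset.mem_erase.2 ⟨h0, (f n).mem_range_self y⟩)]
        · simp
        · intro c _ hc
          exact if_neg fun h => hc (Eq.symm h)
    simp_rw [hprod]
    rw [hX.lintegral_infProd_prod_ite _ (fun c => f n ⁻¹' {c}) (fun c => 1 - c)
      (fun c => (f n).measurableSet_preimage _)
      (fun c hc => hnu n c (Finset.ne_of_mem_erase hc))
      (fun a b hab => Disjoint.preimage _ (by simpa using hab)) fun c => tsub_le_self]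
    congr 3
    rw [SimpleFunc.lintegral_eq_lintegral, SimpleFunc.lintegral, ENNReal.toReal_sum]
    · rw [← Finset.sum_erase (f n).range (a := 0) (by simp)]
      refine Finset.sum_congr rfl fun c hc => ?_
      obtain ⟨y, rfl⟩ := (f n).mem_range.1 (Finset.mem_of_mem_erase hc)
      rw [ENNReal.sub_sub_cancel ENNReal.one_ne_top (hle1 n y), ENNReal.toReal_mul, mul_comm]
    · intro c hc
      by_cases h0 : c = 0
      · simp [h0]
      obtain ⟨y, rfl⟩ := (f n).mem_range.1 hc
      exact ENNReal.mul_ne_top ((hle1 n y).trans_lt ENNReal.one_lt_top).ne (hnu n _ h0)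
  simp_rw [h1]
  rw [lintegral_iInf hmeas]
  · simp_rw [hn]
    have hlim : Tendsto (fun n => ∫⁻ y, f n y ∂ν) atTop (𝓝 (∫⁻ y, (1 - g y) ∂ν)) :=
      lintegral_tendsto_of_tendsto_of_monotone (fun n => (f n).measurable.aemeasurable)
        (ae_of_all _ fun y a b hab => hmono hab y)
        (ae_of_all _ fun y => hsup y ▸ tendsto_atTop_iSup fun a b hab => hmono hab y)
    refine tendsto_nhds_unique (tendsto_atTop_iInf ?_) (ENNReal.tendsto_ofReal
      ((Real.continuous_exp.tendsto _).comp ((ENNReal.tendsto_toReal hint).comp hlim).neg))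
    intro a b hab
    simp_rw [← hn]
    exact lintegral_mono fun ω => infProd_mono fun i => hanti _ hab
  · intro a b hab ω
    exact infProd_mono fun i => hanti _ hab
  · refine ((lintegral_mono fun ω => infProd_le_one _).trans_lt ?_).ne
    simp

end IsPoissonProcess

end

/-! ### Rayleigh fading with independently thinned interferers -/

section

variable {Ω : Type*} [MeasurableSpace Ω] {μ : Measure Ω}

/-- Two independent families of independent variables form a family of independent pairs. -/
theorem iIndepFun_prodMk {ι α β : Type*} [MeasurableSpace α] [MeasurableSpace β]
    [IsProbabilityMeasure μ] {X : ι → Ω → α} {Y : ι → Ω → β}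
    (hX : iIndepFun X μ) (hY : iIndepFun Y μ)
    (hXm : ∀ i, Measurable (X i)) (hYm : ∀ i, Measurable (Y i))
    (h : IndepFun (fun ω i => X i ω) (fun ω i => Y i ω) μ) :
    iIndepFun (fun i ω => (X i ω, Y i ω)) μ := by
  have key : ∀ (s : Finset ι) (A : ι → Set α) (B : ι → Set β),
      (∀ i, MeasurableSet (A i)) → (∀ i, MeasurableSet (B i)) →
      μ (⋂ i ∈ s, (fun ω => (X i ω, Y i ω)) ⁻¹' (A i ×ˢ B i))
        = (∏ i ∈ s, μ (X i ⁻¹' A i)) * ∏ i ∈ s, μ (Y i ⁻¹' B i) := by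
    intro s A B hA hB
    rw [← hX.measure_inter_preimage_eq_mul s fun i _ => hA i,
      ← hY.measure_inter_preimage_eq_mul s fun i _ => hB i]
    have := h.measure_inter_preimage_eq_mul ((s : Set ι).pi A) ((s : Set ι).pi B)
      (MeasurableSet.pi s.countable_toSet fun i _ => hA i)
      (MeasurableSet.pi s.countable_toSet fun i _ => hB i)
    convert this using 2
    · ext ω
      simp only [Set.mem_iInter, Set.mem_preimage, Set.mem_prod, Set.mem_inter_iff, Set.mem_pi,
        Finset.mem_coe]
      exact ⟨fun h => ⟨fun i hi => (h i hi).1, fun i hi => (h i hi).2⟩,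
        fun h i hi => ⟨h.1 i hi, h.2 i hi⟩⟩
    · congr 1; ext ω; simp
    · congr 1; ext ω; simp
  refine iIndepSets.iIndep (fun i => ((hXm i).prodMk (hYm i)).comap_le)
    (fun i => Set.preimage (fun ω => (X i ω, Y i ω)) ''
      Set.image2 (· ×ˢ ·) {s | MeasurableSet s} {t | MeasurableSet t})
    (fun i => ?_) (fun i => ?_) ?_
  · exact (isPiSystem_prod).comap _
  · rw [← generateFrom_prod, MeasurableSpace.comap_generateFrom]
  · rw [iIndepSets_iff]
    intro s f hf
    have hf' : ∀ i, ∃ A B, MeasurableSet A ∧ MeasurableSet B ∧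
        (i ∈ s → f i = (fun ω => (X i ω, Y i ω)) ⁻¹' (A ×ˢ B)) := by
      intro i
      by_cases hi : i ∈ s
      · obtain ⟨_, ⟨A, hA, B, hB, rfl⟩, h⟩ := hf i hi
        exact ⟨A, B, hA, hB, fun _ => h.symm⟩
      · exact ⟨∅, ∅, .empty, .empty, fun h => absurd h hi⟩
    choose A B hA hB hAB using hf'
    rw [Set.iInter₂_congr fun i hi => hAB i hi, key s A B hA hB, ← Finset.prod_mul_distrib]
    refine Finset.prod_congr rfl fun i hi => ?_
    have := key {i} A B hA hB
    rw [hAB i hi]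
    simpa using this.symm

theorem expMeasure_Ici {z : ℝ} (hz : 0 ≤ z) :
    expMeasure 1 (Set.Ici z) = ENNReal.ofReal (Real.exp (-z)) := by
  have := isProbabilityMeasure_expMeasure one_pos
  have h0 : expMeasure 1 {z} = 0 :=
    withDensity_absolutelyContinuous volume _ Real.volume_singleton
  have h1 : expMeasure 1 (Set.Iic z) = ENNReal.ofReal (1 - Real.exp (-z)) := by
    rw [← ENNReal.ofReal_toReal (measure_ne_top (expMeasure 1) (Set.Iic z)),
      ← Measure.real, ← cdf_eq_real, cdf_expMeasure_eq one_pos, if_pos hz, one_mul]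
  have h2 : expMeasure 1 (Set.Iio z) = ENNReal.ofReal (1 - Real.exp (-z)) := by
    rw [← h1, ← Set.Iio_union_right]
    exact le_antisymm (measure_mono Set.subset_union_left)
      ((measure_union_le _ _).trans (by rw [h0, add_zero]))
  rw [← Set.compl_Iio, prob_compl_eq_one_sub measurableSet_Iio, h2, ← ENNReal.ofReal_one,
    ← ENNReal.ofReal_sub _ (by simpa using hz)]
  congr 1; ring

theorem lintegral_exp_expMeasure {c : ℝ} (hc : 0 ≤ c) :
    ∫⁻ x, ENNReal.ofReal (Real.exp (-(c * max x 0))) ∂(expMeasure 1)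
      = ENNReal.ofReal (1 / (1 + c)) := by
  have h1 : expMeasure 1 = volume.withDensity (exponentialPDF 1) := rfl
  have hm : ∀ r, Measurable (exponentialPDF r) := fun r =>
    (measurable_exponentialPDFReal r).ennreal_ofReal
  rw [h1, lintegral_withDensity_eq_lintegral_mul _ (hm 1) (by fun_prop)]
  -- Tilting the density gives a multiple of the exponential density of rate `1 + c`.
  have h2 : ∀ x, (exponentialPDF 1 * fun x => ENNReal.ofReal (Real.exp (-(c * max x 0)))) x
      = ENNReal.ofReal (1 / (1 + c)) * exponentialPDF (1 + c) x := by
    intro x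
    rw [Pi.mul_apply, exponentialPDF_eq, exponentialPDF_eq]
    split_ifs with hx
    · rw [← ENNReal.ofReal_mul (by positivity), ← ENNReal.ofReal_mul (by positivity),
        max_eq_left hx, ← mul_assoc, one_div, inv_mul_cancel₀ (by positivity), one_mul, one_mul,
        one_mul, ← Real.exp_add]
      congr 2; ring
    · simp
  simp_rw [h2]
  rw [lintegral_const_mul _ (hm _), lintegral_exponentialPDF_eq_one (by positivity), mul_one]

/-- An exponential variable exceeds an independent nonnegative one `Z` with probability
`𝔼 exp (-Z)`. -/
theorem measure_le_of_exponential [IsProbabilityMeasure μ] {g Z : Ω → ℝ} (hg : Measurable g)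
    (hZ : Measurable Z) (hlaw : μ.map g = expMeasure 1) (hind : IndepFun Z g μ)
    (hZ0 : ∀ ω, 0 ≤ Z ω) :
    μ {ω | Z ω ≤ g ω} = ∫⁻ ω, ENNReal.ofReal (Real.exp (-Z ω)) ∂μ := by
  have hS : MeasurableSet {q : ℝ × ℝ | q.1 ≤ q.2} := measurableSet_le measurable_fst measurable_snd
  have h1 := (indepFun_iff_map_prod_eq_prod_map_map hZ.aemeasurable hg.aemeasurable).1 hind
  have h2 : μ {ω | Z ω ≤ g ω} = μ.map (fun ω => (Z ω, g ω)) {q : ℝ × ℝ | q.1 ≤ q.2} := by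
    rw [Measure.map_apply (hZ.prodMk hg) hS]; rfl
  have := isProbabilityMeasure_expMeasure one_pos
  rw [h2, h1, hlaw, Measure.prod_apply hS, lintegral_map (measurable_measure_prodMk_left hS) hZ]
  exact lintegral_congr fun ω => expMeasure_Ici (hZ0 ω)

/-- The Laplace transform of an exponential variable that is present with probability `p`. -/
theorem lintegral_exp_thinned [IsProbabilityMeasure μ] {g : Ω → ℝ} {k : Ω → Bool} {p c : ℝ}
    (hg : Measurable g) (hk : Measurable k) (hlaw : μ.map g = expMeasure 1)
    (hp : μ.real {ω | k ω = true} = p) (hind : IndepFun g k μ) (hc : 0 ≤ c) :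
    ∫⁻ ω, ENNReal.ofReal (Real.exp (-(if k ω then c * max (g ω) 0 else 0))) ∂μ
      = ENNReal.ofReal (1 - p + p / (1 + c)) := by
  have hp0 : 0 ≤ p := hp ▸ measureReal_nonneg
  have hp1 : p ≤ 1 := hp ▸ measureReal_le_one
  have hK : MeasurableSet {ω | k ω = true} := hk (measurableSet_singleton true)
  have hPk : μ {ω | k ω = true} = ENNReal.ofReal p := by
    rw [← hp, ofReal_measureReal]
  set F : ℝ → ℝ≥0∞ := fun x => ENNReal.ofReal (Real.exp (-(c * max x 0))) with hF
  have hFm : Measurable F := by fun_prop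
  have h1 : ∀ ω, ENNReal.ofReal (Real.exp (-(if k ω then c * max (g ω) 0 else 0)))
      = {ω | k ω = true}ᶜ.indicator 1 ω + F (g ω) * (if k ω then 1 else 0) := by
    intro ω
    cases h : k ω <;> simp [h, hF]
  simp_rw [h1]
  rw [lintegral_add_left (measurable_one.indicator hK.compl), lintegral_indicator_one hK.compl,
    prob_compl_eq_one_sub hK, hPk]
  have h2 : ∫⁻ ω, F (g ω) * (if k ω then 1 else 0) ∂μ
      = (∫⁻ ω, F (g ω) ∂μ) * ∫⁻ ω, (if k ω then 1 else 0) ∂μ :=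
    lintegral_mul_eq_lintegral_mul_lintegral_of_indepFun (hFm.comp hg)
      ((Measurable.of_discrete (f := fun b : Bool => (if b then 1 else 0 : ℝ≥0∞))).comp hk)
      (hind.comp hFm (Measurable.of_discrete (f := fun b : Bool => (if b then 1 else 0 : ℝ≥0∞))))
  have h3 : ∫⁻ ω, (if k ω then 1 else 0 : ℝ≥0∞) ∂μ = ENNReal.ofReal p := by
    rw [← hPk, ← lintegral_indicator_one hK]
    exact lintegral_congr fun ω => by simp [Set.indicator]
  rw [h2, h3, ← lintegral_map hFm hg, hlaw, lintegral_exp_expMeasure hc, ← ENNReal.ofReal_mul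
    (by positivity), ← ENNReal.ofReal_one, ← ENNReal.ofReal_sub _ hp0, ← ENNReal.ofReal_add
    (by linarith) (by positivity)]
  congr 1; ring

/-- The probability that an exponential signal exceeds a constant plus the interference of
independently thinned exponential signals. -/
theorem measure_interference_le [IsProbabilityMeasure μ] {g : ℕ → Ω → ℝ} {k : ℕ → Ω → Bool}
    {p θ : ℝ} {c : ℕ → ℝ} (i₀ : ℕ)
    (hg : ∀ i, Measurable (g i)) (hk : ∀ i, Measurable (k i))
    (hlaw : ∀ i, μ.map (g i) = expMeasure 1) (hp : ∀ i, μ.real {ω | k i ω = true} = p)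
    (hind : ∀ i, IndepFun (g i) (k i) μ) (hiind : iIndepFun (fun i ω => (g i ω, k i ω)) μ)
    (hθ : 0 < θ) (hc : ∀ i, 0 ≤ c i) (hc₀ : c i₀ = 0) :
    μ {ω | ENNReal.ofReal θ + ∑' i, (if k i ω then ENNReal.ofReal (c i) * ENNReal.ofReal (g i ω)
        else 0) ≤ ENNReal.ofReal (g i₀ ω)}
      = ENNReal.ofReal (Real.exp (-θ)) *
        infProd fun i => ENNReal.ofReal (1 - p + p / (1 + c i)) := by
  have hp0 : 0 ≤ p := hp 0 ▸ measureReal_nonneg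
  have hp1 : p ≤ 1 := hp 0 ▸ measureReal_le_one
  set y : ℕ → ℝ × Bool → ℝ := fun i q => if q.2 then c i * max q.1 0 else 0 with hy
  have hy0 : ∀ i q, 0 ≤ y i q := by
    intro i q
    have := hc i
    simp only [hy]; split_ifs <;> positivity
  have hym : ∀ i, Measurable (y i) := fun i =>
    Measurable.ite (measurable_snd (measurableSet_singleton true)) (by fun_prop) measurable_const
  set Z : ℕ → Ω → ℝ := fun n ω => θ + ∑ i ∈ Finset.range n, y i (g i ω, k i ω) with hZ
  have hgk : ∀ i, Measurable fun ω => (g i ω, k i ω) := fun i => (hg i).prodMk (hk i)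
  have hZm : ∀ n, Measurable (Z n) := fun n =>
    measurable_const.add (Finset.measurable_fun_sum _ fun i _ => (hym i).comp (hgk i))
  have hZθ : ∀ n ω, θ ≤ Z n ω := fun n ω =>
    le_add_of_nonneg_right (Finset.sum_nonneg fun i _ => hy0 _ _)
  have hZmono : ∀ ω, Monotone fun n => Z n ω := by
    refine fun ω => monotone_nat_of_le_succ fun n => ?_
    simp only [hZ, Finset.sum_range_succ]
    linarith [hy0 n (g n ω, k n ω)]
  -- The event is the decreasing limit of the events with finitely many interferers.
  have hset : {ω | ENNReal.ofReal θ + ∑' i, (if k i ω then ENNReal.ofReal (c i) *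
      ENNReal.ofReal (g i ω) else 0) ≤ ENNReal.ofReal (g i₀ ω)} = ⋂ n, {ω | Z n ω ≤ g i₀ ω} := by
    ext ω
    have h1 : ∀ i, (if k i ω then ENNReal.ofReal (c i) * ENNReal.ofReal (g i ω) else 0)
        = ENNReal.ofReal (y i (g i ω, k i ω)) := by
      intro i
      cases hki : k i ω
      · simp [hy]
      · simp only [hy, if_true, ENNReal.ofReal_mul (hc i)]
        congr 1
        rcases le_total (g i ω) 0 with h | h <;> simp [h]
    rw [Set.mem_iInter, Set.mem_ofPred_eq, tsum_congr h1, ENNReal.tsum_eq_iSup_nat,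
      ENNReal.add_iSup, iSup_le_iff]
    refine forall_congr' fun n => ?_
    rw [← ENNReal.ofReal_sum_of_nonneg fun i _ => hy0 _ _, ← ENNReal.ofReal_add hθ.le
      (Finset.sum_nonneg fun i _ => hy0 _ _), ENNReal.ofReal_le_ofReal_iff']
    have := hZθ n ω
    simp only [hZ, Set.mem_ofPred_eq] at this ⊢
    constructor
    · rintro (h | h)
      · exact h
      · linarith
    · exact Or.inl
  have hprob : ∀ n, μ {ω | Z n ω ≤ g i₀ ω} = ENNReal.ofReal (Real.exp (-θ)) *
      ∏ i ∈ Finset.range n, ENNReal.ofReal (1 - p + p / (1 + c i)) := by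
    intro n
    have hindZ : IndepFun (Z n) (g i₀) μ := by
      -- `g i₀` does not occur in the sum because `c i₀ = 0`.
      set φ : ℕ → ℝ × Bool → ℝ := fun i => if i = i₀ then Prod.fst else y i with hφ
      have hφm : ∀ i, Measurable (φ i) := by
        intro i
        simp only [hφ]; split_ifs
        · exact measurable_fst
        · exact hym i
      have h1 := (hiind.comp φ hφm).indepFun_finsetSum_of_notMem
        (fun i => (hφm i).comp (hgk i)) (Finset.notMem_erase i₀ (Finset.range n))
      have h2 := h1.comp (φ := fun x => θ + x) (ψ := id) (by fun_prop) measurable_id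
      convert h2 using 1
      · ext ω
        simp only [hZ, Function.comp, Finset.sum_apply]
        rw [← Finset.sum_erase (Finset.range n) (a := i₀) (by simp [hy, hc₀])]
        congr 1
        refine Finset.sum_congr rfl fun i hi => ?_
        simp [hφ, Finset.ne_of_mem_erase hi]
      · ext ω
        simp [hφ]
    rw [measure_le_of_exponential (hg i₀) (hZm n) (hlaw i₀) hindZ fun ω => hθ.le.trans (hZθ n ω)]
    have h3 : ∀ ω, ENNReal.ofReal (Real.exp (-Z n ω)) = ENNReal.ofReal (Real.exp (-θ)) *
        ∏ i ∈ Finset.range n, ENNReal.ofReal (Real.exp (-y i (g i ω, k i ω))) := by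
      intro ω
      rw [← ENNReal.ofReal_prod_of_nonneg fun i _ => (Real.exp_pos _).le, ← Real.exp_sum,
        ← ENNReal.ofReal_mul (Real.exp_pos _).le, ← Real.exp_add, Finset.sum_neg_distrib,
        ← neg_add]
    simp_rw [h3]
    have hem : ∀ i, Measurable fun q => ENNReal.ofReal (Real.exp (-y i q)) := fun i =>
      (Real.measurable_exp.comp (hym i).neg).ennreal_ofReal
    have hpm : Measurable fun ω =>
        ∏ i ∈ Finset.range n, ENNReal.ofReal (Real.exp (-y i (g i ω, k i ω))) :=
      Finset.measurable_fun_prod _ fun i _ => (hem i).comp (hgk i)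
    rw [lintegral_const_mul _ hpm]
    congr 1
    have h4 := lintegral_prod_eq_prod_lintegral_of_indepFun (Finset.range n) _
      (hiind.comp (fun i q => ENNReal.ofReal (Real.exp (-y i q))) hem)
      fun i => (hem i).comp (hgk i)
    refine h4.trans (Finset.prod_congr rfl fun i _ => ?_)
    exact lintegral_exp_thinned (hg i) (hk i) (hlaw i) (hp i) (hind i) (hc i)
  rw [hset]
  refine tendsto_nhds_unique (tendsto_measure_iInter_atTop
    (fun n => (measurableSet_le (hZm n) (hg i₀)).nullMeasurableSet)
    (fun a b hab ω hω => (hZmono ω hab).trans hω) ⟨0, measure_ne_top _ _⟩) ?_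
  refine Tendsto.congr (fun n => (hprob n).symm) ?_
  refine ENNReal.Tendsto.const_mul (tendsto_infProd fun i => ?_) (Or.inr ENNReal.ofReal_ne_top)
  have := hc i
  rw [ENNReal.ofReal_le_one]
  have : p / (1 + c i) ≤ p := div_le_self hp0 (by linarith)
  linarith

end

/-! ### The distance to the nearest point -/

section

/-- The first index of a point of the sequence that is nearest to the origin, and `0` if the
distances have no minimum. -/
noncomputable def nearest (x : ℕ → Plane) : ℕ := sInf {i | ∀ j, ‖x i‖ ≤ ‖x j‖}

/-- The distance from the origin to its nearest point of the sequence. -/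
noncomputable def nearestDist (x : ℕ → Plane) : ℝ := ‖x (nearest x)‖

theorem measurable_nearest : Measurable nearest := by
  have hP : ∀ i : ℕ, MeasurableSet {x : ℕ → Plane | ∀ j, ‖x i‖ ≤ ‖x j‖} := fun i => by
    have : {x : ℕ → Plane | ∀ j, ‖x i‖ ≤ ‖x j‖} = ⋂ j, {x | ‖x i‖ ≤ ‖x j‖} := by ext; simp
    rw [this]
    exact MeasurableSet.iInter fun j =>
      measurableSet_le (measurable_pi_apply i).norm (measurable_pi_apply j).norm
  refine measurable_of_Ici fun n => ?_
  rcases Nat.eq_zero_or_pos n with rfl | hn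
  · simp
  have : nearest ⁻¹' Set.Ici n = (⋃ i, {x : ℕ → Plane | ∀ j, ‖x i‖ ≤ ‖x j‖}) ∩
      ⋂ i ∈ Set.Iio n, {x : ℕ → Plane | ∀ j, ‖x i‖ ≤ ‖x j‖}ᶜ := by
    ext x
    simp only [Set.mem_preimage, Set.mem_Ici, Set.mem_inter_iff, Set.mem_iUnion, Set.mem_iInter,
      Set.mem_Iio, Set.mem_compl_iff]
    constructor
    · intro h
      refine ⟨Nat.nonempty_of_pos_sInf (hn.trans_le h), fun i hi hmem => ?_⟩
      exact absurd (h.trans (Nat.sInf_le hmem)) (not_le.2 hi)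
    · rintro ⟨⟨i, hi⟩, h⟩
      by_contra hlt
      exact h _ (not_le.1 hlt) (Nat.sInf_mem (s := {i | ∀ j, ‖x i‖ ≤ ‖x j‖}) ⟨i, hi⟩)
  rw [this]
  exact (MeasurableSet.iUnion hP).inter
    (MeasurableSet.biInter (Set.to_countable _) fun i _ => (hP i).compl)

theorem measurable_eval_of_nat {α β : Type*} [MeasurableSpace α] [MeasurableSpace β]
    {f : ℕ → α → β} {n : α → ℕ} (hf : ∀ i, Measurable (f i)) (hn : Measurable n) :
    Measurable fun a => f (n a) a :=
  (measurable_from_prod_countable_right (f := fun q : ℕ × α => f q.1 q.2) hf).comp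
    (hn.prodMk measurable_id)

theorem measurable_nearestDist : Measurable nearestDist :=
  measurable_eval_of_nat (fun i => (measurable_pi_apply i).norm) measurable_nearest

/-! ### The coverage probability given the positions of the base stations -/

namespace Params

variable (N : Params)

/-- The probability with which a base station is active and sends an uncached packet. -/
noncomputable def pInterf : ℝ := N.pActive * (N.Pa1 / (N.Pa1 + N.Pa2))

theorem threshold_pos : 0 < N.threshold := by
  have h := Real.one_lt_rpow one_lt_two (div_pos N.T_pos (mul_pos N.τ_pos N.B_pos))
  exact sub_pos.2 h

theorem sum_airReq_compl : ∑ j ∈ N.cachedᶜ, N.airReq j = N.Pa1 := by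
  have h1 : ∀ j ∈ N.cachedᶜ, N.airReq j = N.f j * N.req := fun j hj => by
    rw [airReq, if_neg (Finset.mem_compl.1 hj)]
  have h2 := Finset.sum_add_sum_compl N.cached N.f
  rw [Finset.sum_congr rfl h1, ← Finset.sum_mul, Pa1, hit]
  rw [N.f_sum] at h2
  rw [← h2]; ring

theorem sum_airReq : ∑ j, N.airReq j = N.Pa1 + N.Pa2 := by
  have h1 : ∀ j ∈ N.cached, N.airReq j = (1 - N.α) * N.f j * N.req := fun j hj => by
    rw [airReq, if_pos hj]
  rw [← Finset.sum_add_sum_compl N.cached, sum_airReq_compl, Finset.sum_congr rfl h1,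
    ← Finset.sum_mul, ← Finset.mul_sum, Pa2, hit, add_comm]

/-- The mean, over fading and thinning, of the factor that a base station at `t ≥ 1` times the
serving distance contributes to the coverage probability. -/
noncomputable def factor (t : ℝ) : ℝ :=
  1 - N.pInterf + N.pInterf / (1 + N.threshold * t ^ (-N.β))

end Params

variable {Ω : Type*} [MeasurableSpace Ω] {μ : Measure Ω} {N : Params} {S : BaseStations Ω N}

/-- Whether the base station, if it is outside the serving disc, is an uncancelled interferer. -/
def BaseStations.kept (S : BaseStations Ω N) (i : ℕ) (ω : Ω) : Bool :=
  S.active i ω && decide (S.packet i ω ∉ N.cached)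

theorem measurable_and_notMem_cached {α : Type*} [MeasurableSpace α] {u : α → Bool}
    {v : α → Fin N.C} (hu : Measurable u) (hv : Measurable v) :
    Measurable fun a => (u a && decide (v a ∉ N.cached)) :=
  (Measurable.of_discrete (f := fun q : Bool × Fin N.C => q.1 && decide (q.2 ∉ N.cached))).comp
    (hu.prodMk hv)

namespace IsNetwork

theorem measurable_kept (hS : IsNetwork N μ S) (i : ℕ) : Measurable (S.kept i) :=
  measurable_and_notMem_cached (hS.active_measurable i) (hS.packet_measurable i)

variable [IsProbabilityMeasure μ]

theorem measureReal_kept (hS : IsNetwork N μ S) (i : ℕ) :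
    μ.real {ω | S.kept i ω = true} = N.pInterf := by
  have h1 : {ω | S.kept i ω = true} =
      S.active i ⁻¹' {true} ∩ S.packet i ⁻¹' {j | j ∉ N.cached} := by
    ext ω; simp [BaseStations.kept]
  have h2 : IndepFun (S.active i) (S.packet i) μ :=
    hS.indep_active.comp (measurable_pi_apply i) (measurable_pi_apply i)
  have h3 : μ.real (S.packet i ⁻¹' {j | j ∉ N.cached}) = N.Pa1 / (N.Pa1 + N.Pa2) := by
    have h4 : S.packet i ⁻¹' {j | j ∉ N.cached} = ⋃ j ∈ N.cachedᶜ, {ω | S.packet i ω = j} := by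
      ext ω; simp
    rw [h4, measureReal_biUnion_finset]
    · simp_rw [hS.packet_law]
      rw [← Finset.sum_div, N.sum_airReq_compl, N.sum_airReq]
    · intro a _ b _ hab
      refine Set.disjoint_left.2 fun ω ha hb => hab ?_
      exact (show S.packet i ω = a from ha).symm.trans hb
    · exact fun j _ => hS.packet_measurable i (measurableSet_singleton j)
  rw [h1, measureReal_def, h2.measure_inter_preimage_eq_mul _ _ (MeasurableSet.of_discrete)
    (MeasurableSet.of_discrete), ENNReal.toReal_mul, ← measureReal_def, ← measureReal_def, h3]
  congr 1
  exact hS.active_law i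

theorem iIndepFun_gain_kept (hS : IsNetwork N μ S) :
    iIndepFun (fun i ω => (S.gain i ω, S.kept i ω)) μ ∧
      ∀ i, IndepFun (S.gain i) (S.kept i) μ := by
  have hk : iIndepFun S.kept μ :=
    (iIndepFun_prodMk hS.active_indep hS.packet_indep hS.active_measurable hS.packet_measurable
      hS.indep_active).comp (fun _ q => q.1 && decide (q.2 ∉ N.cached))
        fun _ => Measurable.of_discrete
  have hm : Measurable fun q : (ℕ → Bool) × (ℕ → Fin N.C) =>
      fun i => (q.1 i && decide (q.2 i ∉ N.cached)) := by
    refine measurable_pi_lambda _ fun i => ?_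
    exact measurable_and_notMem_cached ((measurable_pi_apply i).comp measurable_fst)
      ((measurable_pi_apply i).comp measurable_snd)
  have hgk : IndepFun (fun ω i => S.gain i ω) (fun ω i => S.kept i ω) μ :=
    hS.indep_gain.comp measurable_id hm
  exact ⟨iIndepFun_prodMk hS.gain_indep hk hS.gain_measurable hS.measurable_kept hgk,
    fun i => hgk.comp (measurable_pi_apply i) (measurable_pi_apply i)⟩

end IsNetwork

/-- The total power of the interferers `i` with `k i = true`, as a function of the positions `x`,
the gains `g` and `k`. -/
noncomputable def interfPower (N : Params) (x : ℕ → Plane) (g : ℕ → ℝ) (k : ℕ → Bool) : ℝ≥0∞ :=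
  ∑' i, if nearestDist x < ‖x i‖ ∧ k i = true then
    ENNReal.ofReal (N.P * g i * ‖x i‖ ^ (-N.β)) else 0

/-- Whether the user is covered, that is, whether the signal is at least the threshold times
interference plus noise, as a relation between the positions `x`, the gains `g`, and the
indicator `k` of the interferers. -/
def Covered (N : Params) (x : ℕ → Plane) (g : ℕ → ℝ) (k : ℕ → Bool) : Prop :=
  ENNReal.ofReal N.threshold * (interfPower N x g k + ENNReal.ofReal N.noise)
    ≤ ENNReal.ofReal (N.P * g (nearest x) * nearestDist x ^ (-N.β))

theorem measurableSet_covered (N : Params) :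
    MeasurableSet {q : (ℕ → Plane) × (ℕ → ℝ) × (ℕ → Bool) | Covered N q.1 q.2.1 q.2.2} := by
  have hd : Measurable fun q : (ℕ → Plane) × (ℕ → ℝ) × (ℕ → Bool) => nearestDist q.1 :=
    measurable_nearestDist.comp measurable_fst
  have hx : ∀ i, Measurable fun q : (ℕ → Plane) × (ℕ → ℝ) × (ℕ → Bool) => ‖q.1 i‖ := fun i =>
    ((measurable_pi_apply i).comp measurable_fst).norm
  have hg : ∀ i, Measurable fun q : (ℕ → Plane) × (ℕ → ℝ) × (ℕ → Bool) => q.2.1 i := fun i =>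
    (measurable_pi_apply i).comp (measurable_fst.comp measurable_snd)
  have hk : ∀ i, Measurable fun q : (ℕ → Plane) × (ℕ → ℝ) × (ℕ → Bool) => q.2.2 i := fun i =>
    (measurable_pi_apply i).comp (measurable_snd.comp measurable_snd)
  have hg₀ : Measurable fun q : (ℕ → Plane) × (ℕ → ℝ) × (ℕ → Bool) => q.2.1 (nearest q.1) :=
    measurable_eval_of_nat hg (measurable_nearest.comp measurable_fst)
  refine measurableSet_le ?_ ?_
  · refine measurable_const.mul (Measurable.add_const (Measurable.tsum fun i => ?_) _)
    refine Measurable.ite ((measurableSet_lt hd (hx i)).inter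
      (hk i (measurableSet_singleton true))) ?_ measurable_const
    exact (((hg i).const_mul _).mul ((hx i).pow_const _)).ennreal_ofReal
  · exact ((hg₀.const_mul _).mul (hd.pow_const _)).ennreal_ofReal

/-- Coverage, solved for the gain of the serving channel. -/
theorem covered_iff {N : Params} {x : ℕ → Plane} (hx : 0 < nearestDist x) (g : ℕ → ℝ)
    (k : ℕ → Bool) :
    Covered N x g k ↔
      ENNReal.ofReal (nearestDist x ^ N.β * N.P⁻¹ * N.threshold * N.noise) +
        ∑' i, (if k i then ENNReal.ofReal (if nearestDist x < ‖x i‖ then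
          N.threshold * (‖x i‖ / nearestDist x) ^ (-N.β) else 0) * ENNReal.ofReal (g i) else 0)
        ≤ ENNReal.ofReal (g (nearest x)) := by
  set d := nearestDist x with hd
  have hP := N.P_pos
  have hT := N.threshold_pos
  have hn := N.noise_pos
  have hdβ : 0 < d ^ N.β := Real.rpow_pos_of_pos hx _
  have hK : 0 < d ^ N.β * N.P⁻¹ := by positivity
  have hK0 : ENNReal.ofReal (d ^ N.β * N.P⁻¹) ≠ 0 := (ENNReal.ofReal_pos.2 hK).ne'
  have h1 : ENNReal.ofReal (d ^ N.β * N.P⁻¹) *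
      ENNReal.ofReal (N.P * g (nearest x) * d ^ (-N.β)) = ENNReal.ofReal (g (nearest x)) := by
    rw [← ENNReal.ofReal_mul hK.le, Real.rpow_neg hx.le]
    congr 1
    field_simp
  have h2 : ∀ i, ENNReal.ofReal (d ^ N.β * N.P⁻¹ * N.threshold) *
      (if d < ‖x i‖ ∧ k i = true then ENNReal.ofReal (N.P * g i * ‖x i‖ ^ (-N.β)) else 0)
      = if k i then ENNReal.ofReal (if d < ‖x i‖ then
          N.threshold * (‖x i‖ / d) ^ (-N.β) else 0) * ENNReal.ofReal (g i) else 0 := by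
    intro i
    by_cases hi : d < ‖x i‖
    · cases hk : k i
      · simp
      · have hxi : 0 < ‖x i‖ := hx.trans hi
        have := Real.rpow_pos_of_pos hxi N.β
        have := Real.rpow_pos_of_pos (div_pos hxi hx) (-N.β)
        simp only [hi, and_self, if_true]
        rw [← ENNReal.ofReal_mul (by positivity), ← ENNReal.ofReal_mul (by positivity)]
        congr 1
        rw [Real.rpow_neg (by positivity), Real.rpow_neg (by positivity),
          Real.div_rpow hxi.le hx.le]
        field_simp
    · simp [hi]
  have hc : ENNReal.ofReal (d ^ N.β * N.P⁻¹) * (ENNReal.ofReal N.threshold *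
      (interfPower N x g k + ENNReal.ofReal N.noise))
      = ENNReal.ofReal (d ^ N.β * N.P⁻¹ * N.threshold * N.noise) +
        ∑' i, (if k i then ENNReal.ofReal (if d < ‖x i‖ then
          N.threshold * (‖x i‖ / d) ^ (-N.β) else 0) * ENNReal.ofReal (g i) else 0) := by
    rw [← mul_assoc, ← ENNReal.ofReal_mul hK.le, mul_add, ← ENNReal.ofReal_mul (by positivity),
      add_comm, interfPower, ← ENNReal.tsum_mul_left]
    congr 1
    exact tsum_congr h2
  rw [Covered, ← ENNReal.mul_le_mul_iff_right hK0 ENNReal.ofReal_ne_top, hc, ← hd, h1]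

theorem covered_iff_le_sinr {Ω : Type*} {S : BaseStations Ω N} (ω : Ω) :
    Covered N (fun i => S.loc i ω) (fun i => S.gain i ω) (fun i => S.kept i ω) ↔
      ENNReal.ofReal N.threshold ≤ S.sinr ω := by
  have hI : interfPower N (fun i => S.loc i ω) (fun i => S.gain i ω) (fun i => S.kept i ω)
      = S.interference ω := by
    classical
    rw [interfPower, BaseStations.interference, tsum_subtype (S.uncancelled ω)
      fun i => ENNReal.ofReal (N.P * S.gain i ω * ‖S.loc i ω‖ ^ (-N.β))]
    refine tsum_congr fun i => ?_
    rw [Set.indicator_apply]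
    refine if_congr ?_ rfl rfl
    simp only [BaseStations.uncancelled, BaseStations.kept, Set.mem_ofPred_eq, Bool.and_eq_true,
      decide_eq_true_eq]
    rfl
  have hn : ENNReal.ofReal N.noise ≠ 0 := (ENNReal.ofReal_pos.2 N.noise_pos).ne'
  rw [Covered, hI, BaseStations.sinr, ENNReal.le_div_iff_mul_le]
  · rfl
  · exact Or.inl (by simp [N.noise_pos])
  · exact Or.inr ENNReal.ofReal_ne_top

theorem loss_iff {Ω : Type*} {S : BaseStations Ω N} (ω : Ω) :
    N.τ * N.B * Real.logb 2 (1 + (S.sinr ω).toReal) < N.T ↔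
      ¬ ENNReal.ofReal N.threshold ≤ S.sinr ω := by
  have hfin : S.sinr ω ≠ ∞ := by
    refine ENNReal.div_ne_top ENNReal.ofReal_ne_top ?_
    simp [N.noise_pos]
  have hτB := mul_pos N.τ_pos N.B_pos
  have h0 : 0 ≤ (S.sinr ω).toReal := ENNReal.toReal_nonneg
  rw [not_le, ENNReal.lt_ofReal_iff_toReal_lt hfin, Params.threshold, mul_comm, ← lt_div_iff₀ hτB,
    Real.logb_lt_iff_lt_rpow one_lt_two (by linarith), lt_sub_iff_add_lt, add_comm]

variable [IsProbabilityMeasure μ]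

/-- The coverage probability, integrated over fading, activity and packets: given the positions, the
serving channel and the interferers contribute independent factors. -/
theorem IsNetwork.measure_covered (hS : IsNetwork N μ S)
    (hpos : ∀ᵐ ω ∂μ, 0 < nearestDist fun i => S.loc i ω) :
    μ {ω | Covered N (fun i => S.loc i ω) (fun i => S.gain i ω) (fun i => S.kept i ω)}
      = ∫⁻ ω, ENNReal.ofReal (Real.exp (-((nearestDist fun i => S.loc i ω) ^ N.β * N.P⁻¹ *
          N.threshold * N.noise))) *
        infProd (fun i => if ‖S.loc i ω‖ ≤ nearestDist fun i => S.loc i ω then 1 else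
          ENNReal.ofReal (N.factor (‖S.loc i ω‖ / nearestDist fun i => S.loc i ω))) ∂μ := by
  have hL : Measurable fun ω i => S.loc i ω := measurable_pi_lambda _ hS.loc_poisson.measurable
  have hG : Measurable fun ω => ((fun i => S.gain i ω), fun i => S.kept i ω) :=
    (measurable_pi_lambda _ hS.gain_measurable).prodMk (measurable_pi_lambda _ hS.measurable_kept)
  have hm : Measurable fun q : (ℕ → ℝ) × (ℕ → Bool) × (ℕ → Fin N.C) =>
      (q.1, fun i => (q.2.1 i && decide (q.2.2 i ∉ N.cached))) := by
    refine measurable_fst.prodMk (measurable_pi_lambda _ fun i => ?_)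
    exact measurable_and_notMem_cached
      ((measurable_pi_apply i).comp (measurable_fst.comp measurable_snd))
      ((measurable_pi_apply i).comp (measurable_snd.comp measurable_snd))
  have hind : IndepFun (fun ω i => S.loc i ω)
      (fun ω => ((fun i => S.gain i ω), fun i => S.kept i ω)) μ :=
    hS.indep_loc.comp measurable_id hm
  have hC := measurableSet_covered N
  have h1 := (indepFun_iff_map_prod_eq_prod_map_map hL.aemeasurable hG.aemeasurable).1 hind
  have h2 : μ {ω | Covered N (fun i => S.loc i ω) (fun i => S.gain i ω) (fun i => S.kept i ω)}
      = μ.map (fun ω => ((fun i => S.loc i ω), ((fun i => S.gain i ω), fun i => S.kept i ω)))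
        {q : (ℕ → Plane) × (ℕ → ℝ) × (ℕ → Bool) | Covered N q.1 q.2.1 q.2.2} := by
    rw [Measure.map_apply (hL.prodMk hG) hC]; rfl
  rw [h2, h1, Measure.prod_apply hC, lintegral_map (measurable_measure_prodMk_left hC) hL]
  refine lintegral_congr_ae ?_
  filter_upwards [hpos] with ω hω
  set x : ℕ → Plane := fun i => S.loc i ω with hx
  rw [Measure.map_apply hG (measurable_prodMk_left hC)]
  have h3 : (fun ω => ((fun i => S.gain i ω), fun i => S.kept i ω)) ⁻¹' (Prod.mk x ⁻¹'
      {q : (ℕ → Plane) × (ℕ → ℝ) × (ℕ → Bool) | Covered N q.1 q.2.1 q.2.2})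
      = {ω' | ENNReal.ofReal (nearestDist x ^ N.β * N.P⁻¹ * N.threshold * N.noise) +
        ∑' i, (if S.kept i ω' then ENNReal.ofReal (if nearestDist x < ‖x i‖ then
          N.threshold * (‖x i‖ / nearestDist x) ^ (-N.β) else 0) * ENNReal.ofReal (S.gain i ω')
            else 0) ≤ ENNReal.ofReal (S.gain (nearest x) ω')} := by
    ext ω'
    exact covered_iff hω _ _
  have hP := N.P_pos
  have hT := N.threshold_pos
  have hn := N.noise_pos
  rw [h3, measure_interference_le (nearest x) hS.gain_measurable hS.measurable_kept hS.gain_law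
    hS.measureReal_kept hS.iIndepFun_gain_kept.2 hS.iIndepFun_gain_kept.1]
  · congr 2
    ext i
    by_cases hi : ‖x i‖ ≤ nearestDist x
    · rw [if_neg (not_lt.2 hi), if_pos hi]; simp
    · rw [if_pos (not_le.1 hi), if_neg hi, Params.factor]
  · have := Real.rpow_pos_of_pos hω N.β
    positivity
  · intro i
    split_ifs
    · have := Real.rpow_nonneg (div_nonneg (norm_nonneg (x i)) hω.le) (-N.β)
      positivity
    · exact le_rfl
  · exact if_neg (lt_irrefl _)

end

/-! ### The nearest point of a planar Poisson process -/

section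

theorem nearestDist_le {x : ℕ → Plane} (h : ∃ i, ∀ j, ‖x i‖ ≤ ‖x j‖) (j : ℕ) :
    nearestDist x ≤ ‖x j‖ :=
  Nat.sInf_mem (s := {i | ∀ j, ‖x i‖ ≤ ‖x j‖}) h j

theorem smul_volume_closedBall {φ : ℝ} (hφ : 0 < φ) {r : ℝ} (hr : 0 ≤ r) :
    (ENNReal.ofReal φ • (volume : Measure Plane)) (Metric.closedBall 0 r)
      = ENNReal.ofReal (Real.pi * φ * r ^ 2) := by
  rw [Measure.smul_apply, smul_eq_mul, InnerProductSpace.volume_closedBall_of_dim_even (k := 1)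
    (by simp)]
  rw [finrank_euclideanSpace_fin, ← ENNReal.ofReal_pow hr, ← ENNReal.ofReal_mul (by positivity),
    ← ENNReal.ofReal_mul hφ.le]
  congr 1
  simp; ring

variable {Ω : Type*} [MeasurableSpace Ω] {μ : Measure Ω} [IsProbabilityMeasure μ] {φ : ℝ}
  {X : ℕ → Ω → Plane}

namespace IsPoissonProcess

theorem measure_forall_notMem {Ω E : Type*} [MeasurableSpace Ω] [MeasurableSpace E]
    {μ : Measure Ω} {ν : Measure E} {X : ℕ → Ω → E}
    (hX : IsPoissonProcess μ ν X) {A : Set E} (hA : MeasurableSet A) (hν : ν A ≠ ∞) :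
    μ {ω | ∀ i, X i ω ∉ A} = ENNReal.ofReal (Real.exp (-(ν A).toReal)) := by
  have h := hX.count_law A hA hν 0
  rw [poissonMeasure_singleton] at h
  convert h using 2
  · ext ω
    simp [Set.eq_empty_iff_forall_notMem]
  · simp [ENNReal.coe_toNNReal_eq_toReal]

theorem ae_nearestDist_pos
    (hX : IsPoissonProcess μ (ENNReal.ofReal φ • (volume : Measure Plane)) X) :
    ∀ᵐ ω ∂μ, 0 < nearestDist fun i => X i ω := by
  have h0 : (ENNReal.ofReal φ • (volume : Measure Plane)) {0} = 0 := by simp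
  have h := hX.measure_forall_notMem (measurableSet_singleton 0) (by simp [h0])
  rw [h0] at h
  have h1 : ∀ᵐ ω ∂μ, ∀ i, X i ω ∉ ({0} : Set Plane) := by
    have hm : MeasurableSet {ω | ∀ i, X i ω ∉ ({0} : Set Plane)} := by
      rw [Set.ofPred_forall]
      exact MeasurableSet.iInter fun i => (hX.measurable i (measurableSet_singleton 0)).compl
    exact (mem_ae_iff_prob_eq_one hm).2 (by simpa using h)
  filter_upwards [h1] with ω hω
  exact norm_pos_iff.2 (hω _)

/-- Almost surely a nearest point exists: discs contain finitely many points, and some disc is not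
empty. -/
theorem ae_exists_nearest (hφ : 0 < φ)
    (hX : IsPoissonProcess μ (ENNReal.ofReal φ • (volume : Measure Plane)) X) :
    ∀ᵐ ω ∂μ, ∀ j, (nearestDist fun i => X i ω) ≤ ‖X j ω‖ := by
  have hν : ∀ n : ℕ, (ENNReal.ofReal φ • (volume : Measure Plane)) (Metric.closedBall 0 n) ≠ ∞ :=
    fun n => by rw [smul_volume_closedBall hφ n.cast_nonneg]; exact ENNReal.ofReal_ne_top
  have hfin : ∀ᵐ ω ∂μ, ∀ n : ℕ, {i | X i ω ∈ Metric.closedBall 0 (n : ℝ)}.Finite :=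
    ae_all_iff.2 fun n => hX.ae_finite Metric.isClosed_closedBall.measurableSet (hν n)
  have hne : ∀ᵐ ω ∂μ, ∃ n : ℕ, ∃ i, X i ω ∈ Metric.closedBall 0 (n : ℝ) := by
    rw [ae_iff]
    refine le_antisymm (ge_of_tendsto' (x := atTop) (f := fun n : ℕ =>
      ENNReal.ofReal (Real.exp (-(Real.pi * φ * (n : ℝ) ^ 2)))) ?_ fun n => ?_) zero_le
    · rw [← ENNReal.ofReal_zero]
      refine ENNReal.tendsto_ofReal (Real.tendsto_exp_neg_atTop_nhds_zero.comp ?_)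
      exact ((tendsto_pow_atTop two_ne_zero).comp tendsto_natCast_atTop_atTop).const_mul_atTop
        (by positivity)
    · have h := hX.measure_forall_notMem
        (Metric.isClosed_closedBall (x := (0 : Plane)) (ε := n)).measurableSet (hν n)
      rw [smul_volume_closedBall hφ n.cast_nonneg, ENNReal.toReal_ofReal (by positivity)] at h
      rw [← h]
      refine measure_mono fun ω hω i hi => hω ⟨n, i, hi⟩
  filter_upwards [hfin, hne] with ω h1 ⟨n, i, hi⟩
  refine nearestDist_le ?_
  obtain ⟨m, hm, hmin⟩ := (h1 n).toFinset.exists_min_image (fun j => ‖X j ω‖)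
    ⟨i, by simpa using hi⟩
  refine ⟨m, fun j => ?_⟩
  by_cases hj : X j ω ∈ Metric.closedBall 0 (n : ℝ)
  · exact hmin j (by simpa using hj)
  · have h2 : ‖X m ω‖ ≤ n := by simpa using hm
    have h3 : (n : ℝ) < ‖X j ω‖ := by simpa using hj
    linarith

end IsPoissonProcess

/-- The function on the plane that is `0` on the disc of radius `a`, `v` on the annulus of radii `a`
and `b`, and `u ‖y‖` outside. -/
noncomputable def shell (a b : ℝ) (v : ℝ≥0∞) (u : ℝ → ℝ≥0∞) (y : Plane) : ℝ≥0∞ :=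
  if ‖y‖ ≤ a then 0 else if ‖y‖ ≤ b then v else u ‖y‖

theorem measurable_shell (a b : ℝ) (v : ℝ≥0∞) {u : ℝ → ℝ≥0∞} (hu : Measurable u) :
    Measurable (shell a b v u) :=
  Measurable.ite (measurableSet_le measurable_norm measurable_const) measurable_const
    (Measurable.ite (measurableSet_le measurable_norm measurable_const) measurable_const
      (hu.comp measurable_norm))

theorem shell_le_one {a b : ℝ} {v : ℝ≥0∞} {u : ℝ → ℝ≥0∞} (hv : v ≤ 1) (hu : ∀ t, u t ≤ 1)
    (y : Plane) : shell a b v u y ≤ 1 := by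
  unfold shell; split_ifs <;> simp [hv, hu]

theorem lintegral_one_sub_shell (hφ : 0 < φ) {a b : ℝ} (ha : 0 ≤ a) (hab : a ≤ b) (v : ℝ≥0∞)
    (u : ℝ → ℝ≥0∞) :
    ∫⁻ y, (1 - shell a b v u y) ∂(ENNReal.ofReal φ • (volume : Measure Plane))
      = ENNReal.ofReal (Real.pi * φ * a ^ 2)
        + (1 - v) * ENNReal.ofReal (Real.pi * φ * (b ^ 2 - a ^ 2))
        + ∫⁻ y in {y | b < ‖y‖}, (1 - u ‖y‖) ∂(ENNReal.ofReal φ • (volume : Measure Plane)) := by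
  set ν := ENNReal.ofReal φ • (volume : Measure Plane) with hν
  have hA : MeasurableSet (Metric.closedBall (0 : Plane) a) :=
    Metric.isClosed_closedBall.measurableSet
  have hB : MeasurableSet (Metric.closedBall (0 : Plane) b) :=
    Metric.isClosed_closedBall.measurableSet
  have hsub : Metric.closedBall (0 : Plane) a ⊆ Metric.closedBall 0 b :=
    Metric.closedBall_subset_closedBall hab
  have hcompl : (Metric.closedBall (0 : Plane) b)ᶜ = {y | b < ‖y‖} := by ext y; simp
  rw [← lintegral_add_compl _ hB, ← lintegral_inter_add_sdiff _ (Metric.closedBall 0 b) hA,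
    Set.inter_eq_right.2 hsub, hcompl]
  congr 1
  · congr 1
    · rw [← smul_volume_closedBall hφ ha, ← setLIntegral_one]
      refine setLIntegral_congr_fun hA fun y hy => ?_
      have : ‖y‖ ≤ a := by simpa using hy
      simp [shell, this]
    · have h1 : ν (Metric.closedBall 0 b \ Metric.closedBall 0 a)
          = ENNReal.ofReal (Real.pi * φ * (b ^ 2 - a ^ 2)) := by
        rw [measure_sdiff hsub hA.nullMeasurableSet
          (by rw [smul_volume_closedBall hφ ha]; exact ENNReal.ofReal_ne_top),
          smul_volume_closedBall hφ ha, smul_volume_closedBall hφ (ha.trans hab),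
          ← ENNReal.ofReal_sub _ (by positivity)]
        congr 1; ring
      rw [← h1, ← setLIntegral_const]
      refine setLIntegral_congr_fun (hB.diff hA) fun y hy => ?_
      have h2 : ‖y‖ ≤ b := by simpa using hy.1
      have h3 : ¬ ‖y‖ ≤ a := by simpa using hy.2
      simp [shell, h2, h3]
  · refine setLIntegral_congr_fun (hcompl ▸ hB.compl) fun y (hy : b < ‖y‖) => ?_
    have h2 : ¬ ‖y‖ ≤ b := not_le.2 hy
    have h3 : ¬ ‖y‖ ≤ a := fun h => h2 (h.trans hab)
    simp [shell, h2, h3]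

theorem IsPoissonProcess.lintegral_infProd_shell (hφ : 0 < φ)
    (hX : IsPoissonProcess μ (ENNReal.ofReal φ • (volume : Measure Plane)) X)
    {a b : ℝ} (ha : 0 ≤ a) (hab : a ≤ b) {v : ℝ} (hv0 : 0 ≤ v) (hv : v ≤ 1) {u : ℝ → ℝ≥0∞}
    (hu : Measurable u) (hu1 : ∀ t, u t ≤ 1) {J : ℝ} (hJ0 : 0 ≤ J)
    (hJ : ∫⁻ y in {y | b < ‖y‖}, (1 - u ‖y‖) ∂(ENNReal.ofReal φ • (volume : Measure Plane))
      = ENNReal.ofReal J) :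
    ∫⁻ ω, infProd (fun i => shell a b (ENNReal.ofReal v) u (X i ω)) ∂μ
      = ENNReal.ofReal (Real.exp (-(Real.pi * φ * a ^ 2
        + (1 - v) * (Real.pi * φ * (b ^ 2 - a ^ 2)) + J))) := by
  have hv' : ENNReal.ofReal v ≤ 1 := ENNReal.ofReal_le_one.2 hv
  have h0 : 0 ≤ Real.pi * φ * (b ^ 2 - a ^ 2) := by
    have : a ^ 2 ≤ b ^ 2 := by gcongr
    have := Real.pi_pos
    exact mul_nonneg (by positivity) (by linarith)
  have h1v : 0 ≤ 1 - v := by linarith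
  have h : ∫⁻ y, (1 - shell a b (ENNReal.ofReal v) u y)
      ∂(ENNReal.ofReal φ • (volume : Measure Plane)) = ENNReal.ofReal (Real.pi * φ * a ^ 2
        + (1 - v) * (Real.pi * φ * (b ^ 2 - a ^ 2)) + J) := by
    rw [lintegral_one_sub_shell hφ ha hab, hJ, ← ENNReal.ofReal_one, ← ENNReal.ofReal_sub _ hv0,
      ← ENNReal.ofReal_mul h1v, ← ENNReal.ofReal_add (by positivity) (by positivity),
      ← ENNReal.ofReal_add (by positivity) hJ0]
  rw [hX.lintegral_infProd (measurable_shell a b _ hu) (shell_le_one hv' hu1)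
    (by rw [h]; exact ENNReal.ofReal_ne_top), h, ENNReal.toReal_ofReal (by positivity)]

end

/-! ### Increments of the coverage functional over the serving distance -/

section

/-- The conditional coverage probability given the positions `x`: a factor `h d` for the serving
distance `d`, and a factor `w (‖x i‖ / d)` for each point outside the serving disc. -/
noncomputable def coverage (h w : ℝ → ℝ) (x : ℕ → Plane) : ℝ≥0∞ :=
  ENNReal.ofReal (h (nearestDist x)) * infProd fun i =>
    if ‖x i‖ ≤ nearestDist x then 1 else ENNReal.ofReal (w (‖x i‖ / nearestDist x))

theorem measurable_coverage {h w : ℝ → ℝ} (hh : Measurable h) (hw : Measurable w) :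
    Measurable (coverage h w) := by
  refine (hh.comp measurable_nearestDist).ennreal_ofReal.mul (measurable_infProd fun i => ?_)
  have hi : Measurable fun x : ℕ → Plane => ‖x i‖ := (measurable_pi_apply i).norm
  exact Measurable.ite (measurableSet_le hi measurable_nearestDist) measurable_const
    (hw.comp (hi.div measurable_nearestDist)).ennreal_ofReal

/-- If the serving distance lies in `(a, b]`, no point is within `a` and at least one is within `b`;
distances to interferers are measured in units of at least `a`. -/
theorem coverage_add_le {h w : ℝ → ℝ} (hh : AntitoneOn h (Set.Ioi 0))
    (hw1 : ∀ t, w t ≤ 1) (hw : MonotoneOn w (Set.Ici 1))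
    {a b : ℝ} (ha : 0 < a) {x : ℕ → Plane}
    (hx : ∀ j, nearestDist x ≤ ‖x j‖) :
    (nearestDist ⁻¹' Set.Ioc a b).indicator (coverage h w) x + ENNReal.ofReal (h a) *
        infProd (fun i => shell a b 0 (fun t => ENNReal.ofReal (w (t / a))) (x i))
      ≤ ENNReal.ofReal (h a) *
        infProd (fun i => shell a b 1 (fun t => ENNReal.ofReal (w (t / a))) (x i)) := by
  by_cases hmem : nearestDist x ∈ Set.Ioc a b
  · have hd : 0 < nearestDist x := ha.trans hmem.1
    rw [Set.indicator_of_mem (show x ∈ nearestDist ⁻¹' Set.Ioc a b from hmem), coverage,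
      infProd_eq_zero (u := fun i => shell a b 0 (fun t => ENNReal.ofReal (w (t / a))) (x i))
        (nearest x), mul_zero, add_zero]
    · refine mul_le_mul' (ENNReal.ofReal_le_ofReal (hh ha hd hmem.1.le)) (infProd_mono fun i => ?_)
      have h1 : ¬ ‖x i‖ ≤ a := not_le.2 (hmem.1.trans_le (hx i))
      have h1' : a < ‖x i‖ := not_le.1 h1
      unfold shell
      rw [if_neg h1]
      split_ifs with h2 h3 h3
      · exact le_rfl
      · exact absurd (h2.trans hmem.2) h3
      · exact ENNReal.ofReal_le_one.2 (hw1 _)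
      · refine ENNReal.ofReal_le_ofReal (hw ?_ ?_ ?_)
        · exact (one_le_div hd).2 (hx i)
        · exact (one_le_div ha).2 h1'.le
        · exact div_le_div_of_nonneg_left (norm_nonneg _) ha hmem.1.le
    · have h1 : ¬ ‖x (nearest x)‖ ≤ a := not_le.2 hmem.1
      have h2 : ‖x (nearest x)‖ ≤ b := hmem.2
      simp [shell, h1, h2]
  · rw [Set.indicator_of_notMem (show x ∉ nearestDist ⁻¹' Set.Ioc a b from hmem), zero_add]
    refine mul_le_mul_right (infProd_mono fun i => ?_) _
    unfold shell
    split_ifs <;> simp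

/-- If the serving distance lies in `(a, b]`, the nearest point contributes the factor `v`, which is
at most the factor of every other point within `b`; distances to the points beyond `b` are measured
in units of at most `b`. -/
theorem le_coverage_add {h w : ℝ → ℝ} (hh : AntitoneOn h (Set.Ioi 0))
    (hw1 : ∀ t, w t ≤ 1) (hw : MonotoneOn w (Set.Ici 1))
    {a b : ℝ} (ha : 0 < a) (hab : a ≤ b) {x : ℕ → Plane}
    (hx : ∀ j, nearestDist x ≤ ‖x j‖) :
    ENNReal.ofReal (h b) * infProd (fun i =>
        shell a b (ENNReal.ofReal (w 1)) (fun t => ENNReal.ofReal (w (t / b))) (x i))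
      ≤ ENNReal.ofReal (w 1) * (nearestDist ⁻¹' Set.Ioc a b).indicator (coverage h w) x +
        ENNReal.ofReal (h b) *
        infProd (fun i => shell a b 0 (fun t => ENNReal.ofReal (w (t / b))) (x i)) := by
  have hb : 0 < b := ha.trans_le hab
  rcases le_or_gt (nearestDist x) a with h1 | h1
  · rw [infProd_eq_zero (nearest x), mul_zero]
    · exact zero_le
    · have : ‖x (nearest x)‖ ≤ a := h1
      simp [shell, this]
  rcases le_or_gt (nearestDist x) b with h2 | h2
  · have hd : 0 < nearestDist x := ha.trans h1
    rw [Set.indicator_of_mem (show x ∈ nearestDist ⁻¹' Set.Ioc a b from ⟨h1, h2⟩), coverage]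
    refine le_trans ?_ le_self_add
    rw [mul_left_comm]
    refine mul_le_mul' (ENNReal.ofReal_le_ofReal (hh hd hb h2))
      (infProd_le_mul_infProd (fun i => ?_) (fun i => ?_) ENNReal.ofReal_ne_top (nearest x)
        ?_ ?_ fun i _ => ?_)
    · exact shell_le_one (ENNReal.ofReal_le_one.2 (hw1 _))
        (fun t => ENNReal.ofReal_le_one.2 (hw1 _)) _
    · split_ifs
      · exact le_rfl
      · exact ENNReal.ofReal_le_one.2 (hw1 _)
    · have h3 : ¬ ‖x (nearest x)‖ ≤ a := not_le.2 h1
      have h4 : ‖x (nearest x)‖ ≤ b := h2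
      simp [shell, h3, h4]
    · exact if_pos le_rfl
    · have h3 : ¬ ‖x i‖ ≤ a := not_le.2 (h1.trans_le (hx i))
      have h5 : 1 ≤ ‖x i‖ / nearestDist x := (one_le_div hd).2 (hx i)
      unfold shell
      rw [if_neg h3]
      split_ifs with h4 h6 h6
      · exact ENNReal.ofReal_le_one.2 (hw1 _)
      · exact ENNReal.ofReal_le_ofReal (hw (Set.mem_Ici.2 le_rfl) h5 h5)
      · exact ENNReal.ofReal_le_one.2 (hw1 _)
      · refine ENNReal.ofReal_le_ofReal (hw ((one_le_div hb).2 (not_le.1 h4).le) h5 ?_)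
        exact div_le_div_of_nonneg_left (norm_nonneg _) hd h2
  · refine le_trans (mul_le_mul_right (infProd_mono fun i => ?_) _) le_add_self
    have h3 : ¬ ‖x i‖ ≤ b := not_le.2 (h2.trans_le (hx i))
    have h4 : ¬ ‖x i‖ ≤ a := fun h => h3 (h.trans hab)
    simp [shell, h3, h4]

variable {Ω : Type*} [MeasurableSpace Ω] {μ : Measure Ω} [IsProbabilityMeasure μ] {φ κ : ℝ}
  {X : ℕ → Ω → Plane} {h w : ℝ → ℝ}

/-- The coverage probability with a serving distance in `(a, b]`. -/
noncomputable def coverageIoc (μ : Measure Ω) (X : ℕ → Ω → Plane) (h w : ℝ → ℝ) (a b : ℝ) : ℝ :=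
  (∫⁻ ω, (nearestDist ⁻¹' Set.Ioc a b).indicator (coverage h w) (fun i => X i ω) ∂μ).toReal

theorem coverageIoc_nonneg {Ω : Type*} [MeasurableSpace Ω] {μ : Measure Ω} {X : ℕ → Ω → Plane}
    (a b : ℝ) : 0 ≤ coverageIoc μ X h w a b :=
  ENNReal.toReal_nonneg

theorem lintegral_indicator_coverage_ne_top (hh1 : ∀ t, h t ≤ 1) (A : Set ℝ) :
    ∫⁻ ω, (nearestDist ⁻¹' A).indicator (coverage h w) (fun i => X i ω) ∂μ ≠ ∞ := by
  refine ((lintegral_mono (g := fun _ => 1) fun ω => ?_).trans_lt (by simp)).ne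
  refine (Set.indicator_le_self _ _ _).trans ?_
  exact mul_le_one' (ENNReal.ofReal_le_one.2 (hh1 _)) (infProd_le_one _)

theorem measurable_indicator_coverage (hX : ∀ i, Measurable (X i)) (hh : Measurable h)
    (hw : Measurable w) {A : Set ℝ} (hA : MeasurableSet A) :
    Measurable fun ω => (nearestDist ⁻¹' A).indicator (coverage h w) (fun i => X i ω) :=
  ((measurable_coverage hh hw).indicator (measurable_nearestDist hA)).comp
    (measurable_pi_lambda _ hX)

theorem coverageIoc_add (hX : ∀ i, Measurable (X i)) (hh1 : ∀ t, h t ≤ 1) (hhm : Measurable h)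
    (hwm : Measurable w) {a b c : ℝ} (hab : a ≤ b) (hbc : b ≤ c) :
    coverageIoc μ X h w a b + coverageIoc μ X h w b c = coverageIoc μ X h w a c := by
  unfold coverageIoc
  rw [← ENNReal.toReal_add (lintegral_indicator_coverage_ne_top hh1 _)
    (lintegral_indicator_coverage_ne_top hh1 _), ← lintegral_add_left
      (measurable_indicator_coverage hX hhm hwm measurableSet_Ioc)]
  congr 1
  refine lintegral_congr fun ω => ?_
  rw [← Set.Ioc_union_Ioc_eq_Ioc hab hbc, Set.preimage_union, Set.indicator_union_of_disjoint]
  refine Disjoint.preimage _ (Set.disjoint_left.2 fun t h1 h2 => ?_)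
  exact absurd h1.2 (not_le.2 h2.1)

/-- The integral of `1 - w (‖y‖ / a)` outside the disc of radius `a`, against `φ` times the area, is
`κ` times the `φ`-measure `π φ a²` of the disc. -/
def HasExponent (φ κ : ℝ) (w : ℝ → ℝ) : Prop :=
  ∀ a, 0 < a → ∫⁻ y in {y : Plane | a < ‖y‖}, (1 - ENNReal.ofReal (w (‖y‖ / a)))
    ∂(ENNReal.ofReal φ • (volume : Measure Plane)) = ENNReal.ofReal (Real.pi * φ * κ * a ^ 2)

/-- With `Δ` the measure of the annulus, the two generating functionals in the lower bound differ by
the factor `exp (w 1 * Δ)`, and `(exp (w 1 * Δ) - 1) / w 1 ≥ Δ`. -/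
theorem le_coverageIoc (hφ : 0 < φ) (hκ0 : 0 ≤ κ)
    (hX : IsPoissonProcess μ (ENNReal.ofReal φ • (volume : Measure Plane)) X)
    (hh0 : ∀ t, 0 ≤ h t) (hh1 : ∀ t, h t ≤ 1) (hh : AntitoneOn h (Set.Ioi 0)) (hhm : Measurable h)
    (hw0 : 0 < w 1) (hw1 : ∀ t, w t ≤ 1) (hw : MonotoneOn w (Set.Ici 1)) (hwm : Measurable w)
    (hκ : HasExponent φ κ w) {a b : ℝ} (ha : 0 < a) (hab : a ≤ b) :
    h b * Real.exp (-(Real.pi * φ * b ^ 2 * (1 + κ))) * (Real.pi * φ * (b ^ 2 - a ^ 2))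
      ≤ coverageIoc μ X h w a b := by
  have hb : 0 < b := ha.trans_le hab
  have hπ := Real.pi_pos
  have hu : Measurable fun t => ENNReal.ofReal (w (t / b)) :=
    (hwm.comp (measurable_id.div_const b)).ennreal_ofReal
  have hu1 : ∀ t, ENNReal.ofReal (w (t / b)) ≤ 1 := fun t => ENNReal.ofReal_le_one.2 (hw1 _)
  have hJ0 : 0 ≤ Real.pi * φ * κ * b ^ 2 := by positivity
  have hv := hX.lintegral_infProd_shell hφ ha.le hab hw0.le (hw1 1) hu hu1 hJ0 (hκ b hb)
  have h0 := hX.lintegral_infProd_shell hφ ha.le hab le_rfl zero_le_one hu hu1 hJ0 (hκ b hb)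
  rw [ENNReal.ofReal_zero] at h0
  have hm := measurable_indicator_coverage (h := h) (w := w) hX.measurable hhm hwm
    (measurableSet_Ioc (a := a) (b := b))
  have hsm : ∀ v, Measurable fun ω =>
      infProd fun i => shell a b v (fun t => ENNReal.ofReal (w (t / b))) (X i ω) := fun v =>
    measurable_infProd fun i => (measurable_shell a b v hu).comp (hX.measurable i)
  have hint : ∫⁻ ω, ENNReal.ofReal (h b) * infProd (fun i => shell a b (ENNReal.ofReal (w 1))
      (fun t => ENNReal.ofReal (w (t / b))) (X i ω)) ∂μ
      ≤ ∫⁻ ω, (ENNReal.ofReal (w 1) *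
        (nearestDist ⁻¹' Set.Ioc a b).indicator (coverage h w) (fun i => X i ω) +
        ENNReal.ofReal (h b) *
        infProd (fun i => shell a b 0 (fun t => ENNReal.ofReal (w (t / b))) (X i ω))) ∂μ := by
    refine lintegral_mono_ae ?_
    filter_upwards [hX.ae_exists_nearest hφ] with ω hω
    exact le_coverage_add hh hw1 hw ha hab hω
  rw [lintegral_const_mul _ (hsm _), lintegral_add_left (hm.const_mul _), lintegral_const_mul _ hm,
    lintegral_const_mul _ (hsm _), hv, h0,
    ← ENNReal.ofReal_toReal (lintegral_indicator_coverage_ne_top hh1 _), ← coverageIoc,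
    ← ENNReal.ofReal_mul (hh0 b), ← ENNReal.ofReal_mul hw0.le, ← ENNReal.ofReal_mul (hh0 b),
    ← ENNReal.ofReal_add (mul_nonneg hw0.le (coverageIoc_nonneg a b))
      (mul_nonneg (hh0 b) (Real.exp_pos _).le),
    ENNReal.ofReal_le_ofReal_iff (add_nonneg (mul_nonneg hw0.le (coverageIoc_nonneg a b))
      (mul_nonneg (hh0 b) (Real.exp_pos _).le))] at hint
  set Δ := Real.pi * φ * (b ^ 2 - a ^ 2) with hΔ
  have e1 : Real.exp (-(Real.pi * φ * a ^ 2 + (1 - w 1) * Δ + Real.pi * φ * κ * b ^ 2))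
      = Real.exp (-(Real.pi * φ * b ^ 2 * (1 + κ))) * Real.exp (w 1 * Δ) := by
    rw [← Real.exp_add]; congr 1; rw [hΔ]; ring
  have e2 : Real.exp (-(Real.pi * φ * a ^ 2 + (1 - 0) * Δ + Real.pi * φ * κ * b ^ 2))
      = Real.exp (-(Real.pi * φ * b ^ 2 * (1 + κ))) := by
    congr 1; rw [hΔ]; ring
  rw [e1, e2] at hint
  have h3 : 0 ≤ h b * Real.exp (-(Real.pi * φ * b ^ 2 * (1 + κ))) :=
    mul_nonneg (hh0 b) (Real.exp_pos _).le
  have h4 := mul_le_mul_of_nonneg_left (Real.add_one_le_exp (w 1 * Δ)) h3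
  refine le_of_mul_le_mul_left ?_ hw0
  nlinarith

/-- With `Δ` the measure of the annulus, the two generating functionals in the upper bound differ by
the factor `exp (-Δ)`, and `1 - exp (-Δ) ≤ Δ`. -/
theorem coverageIoc_le (hφ : 0 < φ)
    (hX : IsPoissonProcess μ (ENNReal.ofReal φ • (volume : Measure Plane)) X)
    (hh0 : ∀ t, 0 ≤ h t) (hh1 : ∀ t, h t ≤ 1) (hh : AntitoneOn h (Set.Ioi 0)) (hhm : Measurable h)
    (hw1 : ∀ t, w t ≤ 1) (hw : MonotoneOn w (Set.Ici 1)) (hwm : Measurable w)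
    (hκ : HasExponent φ κ w) {a b : ℝ} (ha : 0 < a) (hab : a ≤ b) :
    coverageIoc μ X h w a b ≤ h a * Real.exp (-(Real.pi * φ * a ^ 2 * (1 + κ))) *
      Real.exp (Real.pi * φ * (b ^ 2 - a ^ 2)) * (Real.pi * φ * (b ^ 2 - a ^ 2)) := by
  have hπ := Real.pi_pos
  have hu : Measurable fun t => ENNReal.ofReal (w (t / a)) :=
    (hwm.comp (measurable_id.div_const a)).ennreal_ofReal
  have hu1 : ∀ t, ENNReal.ofReal (w (t / a)) ≤ 1 := fun t => ENNReal.ofReal_le_one.2 (hw1 _)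
  set Δ := Real.pi * φ * (b ^ 2 - a ^ 2) with hΔ
  have hΔ0 : 0 ≤ Δ := by
    have : a ^ 2 ≤ b ^ 2 := by gcongr
    exact mul_nonneg (by positivity) (by linarith)
  set ν := ENNReal.ofReal φ • (volume : Measure Plane) with hν
  -- Beyond `b` instead of `a`, the exponent loses at most the measure `Δ` of the annulus.
  set I := ∫⁻ y in {y : Plane | b < ‖y‖}, (1 - ENNReal.ofReal (w (‖y‖ / a))) ∂ν with hI
  have hsub : {y : Plane | b < ‖y‖} ⊆ {y | a < ‖y‖} := fun y hy => hab.trans_lt hy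
  have hIle : I ≤ ENNReal.ofReal (Real.pi * φ * κ * a ^ 2) := by
    rw [← hκ a ha]
    exact lintegral_mono_set hsub
  have hItop : I ≠ ∞ := (hIle.trans_lt ENNReal.ofReal_lt_top).ne
  have hIge : Real.pi * φ * κ * a ^ 2 ≤ I.toReal + Δ := by
    have h1 : ENNReal.ofReal (Real.pi * φ * κ * a ^ 2) ≤ I + ENNReal.ofReal Δ := by
      have hB : MeasurableSet (Metric.closedBall (0 : Plane) b \ Metric.closedBall 0 a) :=
        Metric.isClosed_closedBall.measurableSet.diff Metric.isClosed_closedBall.measurableSet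
      have hBν : ν (Metric.closedBall 0 b \ Metric.closedBall 0 a) = ENNReal.ofReal Δ := by
        rw [measure_sdiff (Metric.closedBall_subset_closedBall hab)
          Metric.isClosed_closedBall.measurableSet.nullMeasurableSet
          (by rw [smul_volume_closedBall hφ ha.le]; exact ENNReal.ofReal_ne_top),
          smul_volume_closedBall hφ ha.le, smul_volume_closedBall hφ (ha.le.trans hab),
          ← ENNReal.ofReal_sub _ (by positivity)]
        congr 1; rw [hΔ]; ring
      rw [← hκ a ha, ← hBν]
      have h2 : {y : Plane | a < ‖y‖} ⊆
          {y | b < ‖y‖} ∪ (Metric.closedBall 0 b \ Metric.closedBall 0 a) := by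
        intro y hy
        rcases lt_or_ge b ‖y‖ with h | h
        · exact Or.inl h
        · exact Or.inr ⟨by simpa using h, by simpa using hy⟩
      refine (lintegral_mono_set h2).trans ((lintegral_union_le _ _ _).trans ?_)
      refine add_le_add_right ?_ _
      refine (lintegral_mono (g := fun _ => 1) fun y => tsub_le_self).trans ?_
      rw [lintegral_one, Measure.restrict_apply_univ]
    rw [← ENNReal.ofReal_toReal hItop, ← ENNReal.ofReal_add ENNReal.toReal_nonneg hΔ0] at h1
    exact (ENNReal.ofReal_le_ofReal_iff (add_nonneg ENNReal.toReal_nonneg hΔ0)).1 h1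
  have hIJ : I = ENNReal.ofReal I.toReal := (ENNReal.ofReal_toReal hItop).symm
  have hv := hX.lintegral_infProd_shell hφ ha.le hab zero_le_one le_rfl hu hu1
    ENNReal.toReal_nonneg hIJ
  have h0 := hX.lintegral_infProd_shell hφ ha.le hab le_rfl zero_le_one hu hu1
    ENNReal.toReal_nonneg hIJ
  rw [ENNReal.ofReal_zero] at h0
  rw [ENNReal.ofReal_one] at hv
  have hm := measurable_indicator_coverage (h := h) (w := w) hX.measurable hhm hwm
    (measurableSet_Ioc (a := a) (b := b))
  have hsm : ∀ v, Measurable fun ω =>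
      infProd fun i => shell a b v (fun t => ENNReal.ofReal (w (t / a))) (X i ω) := fun v =>
    measurable_infProd fun i => (measurable_shell a b v hu).comp (hX.measurable i)
  have hint : ∫⁻ ω, ((nearestDist ⁻¹' Set.Ioc a b).indicator (coverage h w) (fun i => X i ω) +
        ENNReal.ofReal (h a) *
        infProd (fun i => shell a b 0 (fun t => ENNReal.ofReal (w (t / a))) (X i ω))) ∂μ
      ≤ ∫⁻ ω, ENNReal.ofReal (h a) * infProd (fun i => shell a b 1
      (fun t => ENNReal.ofReal (w (t / a))) (X i ω)) ∂μ := by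
    refine lintegral_mono_ae ?_
    filter_upwards [hX.ae_exists_nearest hφ] with ω hω
    exact coverage_add_le hh hw1 hw ha hω
  rw [lintegral_const_mul _ (hsm _), lintegral_add_left hm,
    lintegral_const_mul _ (hsm _), hv, h0,
    ← ENNReal.ofReal_toReal (lintegral_indicator_coverage_ne_top hh1 _), ← coverageIoc,
    ← ENNReal.ofReal_mul (hh0 a), ← ENNReal.ofReal_mul (hh0 a),
    ← ENNReal.ofReal_add (coverageIoc_nonneg a b) (mul_nonneg (hh0 a) (Real.exp_pos _).le),
    ENNReal.ofReal_le_ofReal_iff (mul_nonneg (hh0 a) (Real.exp_pos _).le)] at hint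
  rw [← hΔ] at hint
  have e1 : Real.exp (-(Real.pi * φ * a ^ 2 + (1 - 1) * Δ + I.toReal))
      ≤ Real.exp (-(Real.pi * φ * a ^ 2 * (1 + κ))) * Real.exp Δ := by
    rw [← Real.exp_add]
    refine Real.exp_le_exp.2 ?_
    nlinarith
  have e2 : Real.exp (-(Real.pi * φ * a ^ 2 + (1 - 0) * Δ + I.toReal))
      = Real.exp (-(Real.pi * φ * a ^ 2 + (1 - 1) * Δ + I.toReal)) * Real.exp (-Δ) := by
    rw [← Real.exp_add]; congr 1; ring
  rw [e2] at hint
  set e := Real.exp (-(Real.pi * φ * a ^ 2 + (1 - 1) * Δ + I.toReal)) with he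
  have hepos : 0 < e := Real.exp_pos _
  calc coverageIoc μ X h w a b ≤ h a * e * (1 - Real.exp (-Δ)) := by linarith
    _ ≤ h a * e * Δ := by
      refine mul_le_mul_of_nonneg_left ?_ (mul_nonneg (hh0 a) hepos.le)
      linarith [Real.add_one_le_exp (-Δ)]
    _ ≤ h a * (Real.exp (-(Real.pi * φ * a ^ 2 * (1 + κ))) * Real.exp Δ) * Δ := by
      have := hh0 a
      gcongr
    _ = _ := by ring

end

/-! ### Integration over the serving distance -/

section

variable {Ω : Type*} [MeasurableSpace Ω] {μ : Measure Ω} [IsProbabilityMeasure μ] {φ κ : ℝ}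
  {X : ℕ → Ω → Plane} {h w : ℝ → ℝ}

/-- The bounds on the increments determine the right derivative. -/
theorem coverageIoc_eq_integral (hφ : 0 < φ) (hκ0 : 0 ≤ κ)
    (hX : IsPoissonProcess μ (ENNReal.ofReal φ • (volume : Measure Plane)) X)
    (hh0 : ∀ t, 0 ≤ h t) (hh1 : ∀ t, h t ≤ 1) (hh : AntitoneOn h (Set.Ioi 0)) (hhm : Measurable h)
    (hhc : ContinuousOn h (Set.Ioi 0))
    (hw0 : 0 < w 1) (hw1 : ∀ t, w t ≤ 1) (hw : MonotoneOn w (Set.Ici 1)) (hwm : Measurable w)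
    (hκ : HasExponent φ κ w) {a b : ℝ} (ha : 0 < a) (hab : a ≤ b) :
    coverageIoc μ X h w a b =
      ∫ r in a..b, 2 * Real.pi * φ * (r * (h r * Real.exp (-(Real.pi * φ * r ^ 2 * (1 + κ))))) := by
  have hπ := Real.pi_pos
  have hlow := fun {x y : ℝ} (hx : 0 < x) (hxy : x ≤ y) => le_coverageIoc hφ hκ0 hX hh0 hh1 hh hhm
    hw0 hw1 hw hwm hκ hx hxy
  have hupp := fun {x y : ℝ} (hx : 0 < x) (hxy : x ≤ y) => coverageIoc_le hφ hX hh0 hh1 hh hhm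
    hw1 hw hwm hκ hx hxy
  have hadd := fun {x y z : ℝ} (hxy : x ≤ y) (hyz : y ≤ z) =>
    coverageIoc_add (μ := μ) hX.measurable hh1 hhm hwm hxy hyz
  have hcontH : ∀ x, 0 < x → ContinuousAt
      (fun r => h r * Real.exp (-(Real.pi * φ * r ^ 2 * (1 + κ)))) x := fun x hx =>
    (hhc.continuousAt (Ioi_mem_nhds hx)).mul (by fun_prop)
  have haa : coverageIoc μ X h w a a = 0 := by simp [coverageIoc]
  have hIcc : ∀ x ∈ Set.uIcc a b, 0 < x := fun x hx => by
    rw [Set.uIcc_of_le hab] at hx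
    exact ha.trans_le hx.1
  have hft := intervalIntegral.integral_eq_sub_of_hasDeriv_right_of_le (a := a) (b := b)
    (f := fun r => coverageIoc μ X h w a r)
    (f' := fun r => 2 * Real.pi * φ * (r * (h r * Real.exp (-(Real.pi * φ * r ^ 2 * (1 + κ))))))
    hab ?_ ?_ ?_
  · rw [hft, haa, sub_zero]
  · -- The increments are at most linear.
    set K := Real.exp (Real.pi * φ * b ^ 2) * (Real.pi * φ * (2 * b)) with hK
    have hK0 : 0 ≤ K := by have := ha.trans_le hab; positivity
    have hinc : ∀ x ∈ Set.Icc a b, ∀ y ∈ Set.Icc a b, x ≤ y →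
        |coverageIoc μ X h w a y - coverageIoc μ X h w a x| ≤ K * |y - x| := by
      intro x hx y hy hxy
      have hx0 := ha.trans_le hx.1
      have hy0 := ha.trans_le hy.1
      rw [← hadd hx.1 hxy, add_sub_cancel_left, abs_of_nonneg (coverageIoc_nonneg x y),
        abs_of_nonneg (sub_nonneg.2 hxy)]
      refine (hupp hx0 hxy).trans ?_
      have h1 : h x * Real.exp (-(Real.pi * φ * x ^ 2 * (1 + κ))) ≤ 1 :=
        mul_le_one₀ (hh1 x) (Real.exp_pos _).le (Real.exp_le_one_iff.2 (by
          have : 0 ≤ Real.pi * φ * x ^ 2 * (1 + κ) := by positivity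
          linarith))
      have hyb : y ^ 2 ≤ b ^ 2 := by gcongr; exact hy.2
      have h2 : Real.exp (Real.pi * φ * (y ^ 2 - x ^ 2)) ≤ Real.exp (Real.pi * φ * b ^ 2) := by
        refine Real.exp_le_exp.2 (mul_le_mul_of_nonneg_left ?_ (by positivity))
        nlinarith [sq_nonneg x]
      have h3 : y ^ 2 - x ^ 2 ≤ 2 * b * (y - x) := by
        have : y + x ≤ 2 * b := by linarith [hx.2, hy.2]
        nlinarith
      have h4 : 0 ≤ y ^ 2 - x ^ 2 := by nlinarith
      calc _ ≤ 1 * Real.exp (Real.pi * φ * b ^ 2) * (Real.pi * φ * (2 * b * (y - x))) := by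
            gcongr
        _ = K * (y - x) := by rw [hK]; ring
    have hL : LipschitzOnWith K.toNNReal (fun r => coverageIoc μ X h w a r) (Set.Icc a b) := by
      refine LipschitzOnWith.of_dist_le_mul fun x hx y hy => ?_
      rw [Real.dist_eq, Real.dist_eq, Real.coe_toNNReal _ hK0]
      rcases le_total x y with hxy | hxy
      · rw [abs_sub_comm, abs_sub_comm x]
        exact hinc x hx y hy hxy
      · exact hinc y hy x hx hxy
    exact hL.continuousOn
  · intro x hx
    have hx0 : 0 < x := ha.trans hx.1
    rw [hasDerivWithinAt_iff_tendsto_slope' (by simp)]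
    have hlim : 2 * Real.pi * φ * (x * (h x * Real.exp (-(Real.pi * φ * x ^ 2 * (1 + κ)))))
        = h x * Real.exp (-(Real.pi * φ * x ^ 2 * (1 + κ))) * (Real.pi * φ * (x + x)) := by ring
    have hlim' : h x * Real.exp (-(Real.pi * φ * x ^ 2 * (1 + κ))) * (Real.pi * φ * (x + x))
        = h x * Real.exp (-(Real.pi * φ * x ^ 2 * (1 + κ))) *
          Real.exp (Real.pi * φ * (x ^ 2 - x ^ 2)) * (Real.pi * φ * (x + x)) := by simp
    have hslope : ∀ y, x < y → slope (fun r => coverageIoc μ X h w a r) x y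
        = coverageIoc μ X h w x y / (y - x) := by
      intro y hy
      rw [slope_def_field, ← hadd hx.1.le hy.le, add_sub_cancel_left]
    have hcl : Tendsto (fun y => h y * Real.exp (-(Real.pi * φ * y ^ 2 * (1 + κ))) *
        (Real.pi * φ * (y + x))) (𝓝[>] x)
        (𝓝 (h x * Real.exp (-(Real.pi * φ * x ^ 2 * (1 + κ))) * (Real.pi * φ * (x + x)))) :=
      tendsto_nhdsWithin_of_tendsto_nhds ((hcontH x hx0).mul
        (by fun_prop : ContinuousAt (fun y => Real.pi * φ * (y + x)) x))
    have hcu : Tendsto (fun y => h x * Real.exp (-(Real.pi * φ * x ^ 2 * (1 + κ))) *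
          Real.exp (Real.pi * φ * (y ^ 2 - x ^ 2)) * (Real.pi * φ * (y + x))) (𝓝[>] x)
        (𝓝 (h x * Real.exp (-(Real.pi * φ * x ^ 2 * (1 + κ))) *
          Real.exp (Real.pi * φ * (x ^ 2 - x ^ 2)) * (Real.pi * φ * (x + x)))) :=
      tendsto_nhdsWithin_of_tendsto_nhds (by
        have : Continuous fun y => h x * Real.exp (-(Real.pi * φ * x ^ 2 * (1 + κ))) *
          Real.exp (Real.pi * φ * (y ^ 2 - x ^ 2)) * (Real.pi * φ * (y + x)) := by fun_prop
        exact this.tendsto x)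
    rw [hlim]
    refine tendsto_of_tendsto_of_tendsto_of_le_of_le' hcl (hlim' ▸ hcu) ?_ ?_
    · filter_upwards [self_mem_nhdsWithin] with y (hy : x < y)
      rw [hslope y hy, le_div_iff₀ (sub_pos.2 hy)]
      refine le_trans (le_of_eq ?_) (hlow hx0 hy.le)
      ring
    · filter_upwards [self_mem_nhdsWithin] with y (hy : x < y)
      rw [hslope y hy, div_le_iff₀ (sub_pos.2 hy)]
      refine (hupp hx0 hy.le).trans (le_of_eq ?_)
      ring
  · refine ContinuousOn.intervalIntegrable fun x hx => ContinuousAt.continuousWithinAt ?_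
    exact continuousAt_const.mul (continuousAt_id.mul (hcontH x (hIcc x hx)))

/-- The coverage probability as an integral over the serving distance `r`, whose density is
`2πφ r exp (-πφ r²)`. -/
theorem lintegral_coverage (hφ : 0 < φ) (hκ0 : 0 ≤ κ)
    (hX : IsPoissonProcess μ (ENNReal.ofReal φ • (volume : Measure Plane)) X)
    (hh0 : ∀ t, 0 ≤ h t) (hh1 : ∀ t, h t ≤ 1) (hh : AntitoneOn h (Set.Ioi 0)) (hhm : Measurable h)
    (hhc : ContinuousOn h (Set.Ioi 0))
    (hw0 : 0 < w 1) (hw1 : ∀ t, w t ≤ 1) (hw : MonotoneOn w (Set.Ici 1)) (hwm : Measurable w)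
    (hκ : HasExponent φ κ w) :
    ∫⁻ ω, coverage h w (fun i => X i ω) ∂μ = ENNReal.ofReal (2 * Real.pi * φ *
      ∫ r in Set.Ioi (0 : ℝ), r * (h r * Real.exp (-(Real.pi * φ * r ^ 2 * (1 + κ))))) := by
  have hπ := Real.pi_pos
  set s : ℕ → Set ℝ := fun n => Set.Ioc (1 / ((n : ℝ) + 1)) (n + 1) with hs
  have hsmono : Monotone s := by
    intro m n hmn
    have : (m : ℝ) ≤ n := by exact_mod_cast hmn
    exact Set.Ioc_subset_Ioc (by gcongr) (by gcongr)
  have hsU : ⋃ n, s n = Set.Ioi 0 := by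
    ext t
    simp only [hs, Set.mem_iUnion, Set.mem_Ioc, Set.mem_Ioi]
    constructor
    · rintro ⟨n, h1, _⟩
      exact lt_trans (by positivity) h1
    · intro ht
      obtain ⟨n, hn⟩ := exists_nat_one_div_lt ht
      obtain ⟨m, hm⟩ := exists_nat_ge t
      refine ⟨max n m, lt_of_le_of_lt ?_ hn, ?_⟩
      · have : (n : ℝ) ≤ (max n m : ℕ) := by exact_mod_cast le_max_left n m
        gcongr
      · have : (m : ℝ) ≤ (max n m : ℕ) := by exact_mod_cast le_max_right n m
        linarith
  set F : ℝ → ℝ := fun r =>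
    2 * Real.pi * φ * (r * (h r * Real.exp (-(Real.pi * φ * r ^ 2 * (1 + κ))))) with hF
  have hFm : Measurable F := by
    have : Measurable fun r : ℝ => Real.exp (-(Real.pi * φ * r ^ 2 * (1 + κ))) := by fun_prop
    exact (measurable_id.mul (hhm.mul this)).const_mul _
  have hFint : IntegrableOn F (Set.Ioi 0) := by
    have h1 : IntegrableOn (fun r : ℝ => r * Real.exp (-(Real.pi * φ * (1 + κ)) * r ^ 2))
        (Set.Ioi 0) := (integrable_mul_exp_neg_mul_sq (by positivity)).integrableOn
    refine (h1.const_mul (2 * Real.pi * φ)).mono' hFm.aestronglyMeasurable ?_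
    refine (ae_restrict_iff' measurableSet_Ioi).2 (ae_of_all _ fun r (hr : 0 < r) => ?_)
    have he : Real.exp (-(Real.pi * φ * r ^ 2 * (1 + κ)))
        = Real.exp (-(Real.pi * φ * (1 + κ)) * r ^ 2) := by congr 1; ring
    have := hh0 r
    rw [Real.norm_of_nonneg (by positivity)]
    simp only [hF, he]
    have h2 : h r * Real.exp (-(Real.pi * φ * (1 + κ)) * r ^ 2)
        ≤ Real.exp (-(Real.pi * φ * (1 + κ)) * r ^ 2) :=
      mul_le_of_le_one_left (Real.exp_pos _).le (hh1 r)
    gcongr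
  have hI : ∀ n : ℕ, ∫⁻ ω, (nearestDist ⁻¹' s n).indicator (coverage h w) (fun i => X i ω) ∂μ
      = ENNReal.ofReal (∫ r in s n, F r) := by
    intro n
    have hn : (1 : ℝ) / ((n : ℝ) + 1) ≤ n + 1 := by
      have h0 : (0 : ℝ) ≤ n := n.cast_nonneg
      rw [div_le_iff₀ (by positivity)]
      nlinarith
    rw [← intervalIntegral.integral_of_le hn, ← coverageIoc_eq_integral hφ hκ0 hX hh0 hh1 hh hhm hhc
      hw0 hw1 hw hwm hκ (by positivity) hn, coverageIoc, ENNReal.ofReal_toReal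
      (lintegral_indicator_coverage_ne_top hh1 _)]
  have hlim1 : Tendsto (fun n => ∫⁻ ω, (nearestDist ⁻¹' s n).indicator (coverage h w)
      (fun i => X i ω) ∂μ) atTop (𝓝 (∫⁻ ω, coverage h w (fun i => X i ω) ∂μ)) := by
    refine lintegral_tendsto_of_tendsto_of_monotone
      (fun n =>
        (measurable_indicator_coverage hX.measurable hhm hwm measurableSet_Ioc).aemeasurable)
      (ae_of_all _ fun ω m n hmn => ?_) ?_
    · exact Set.indicator_le_indicator_of_subset (Set.preimage_mono (hsmono hmn))
        (fun _ => zero_le) _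
    · filter_upwards [hX.ae_nearestDist_pos] with ω hω
      obtain ⟨n, hn⟩ := Set.mem_iUnion.1 (hsU.symm ▸ hω : nearestDist (fun i => X i ω) ∈ ⋃ n, s n)
      refine tendsto_const_nhds.congr' ?_
      filter_upwards [eventually_ge_atTop n] with m hm
      exact (Set.indicator_of_mem (show (fun i => X i ω) ∈ nearestDist ⁻¹' s m from hsmono hm hn)
        _).symm
  have hlim2 : Tendsto (fun n => ENNReal.ofReal (∫ r in s n, F r)) atTop
      (𝓝 (ENNReal.ofReal (∫ r in Set.Ioi 0, F r))) := by
    refine ENNReal.tendsto_ofReal ?_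
    rw [← hsU]
    exact tendsto_setIntegral_of_monotone (fun n => measurableSet_Ioc) hsmono (hsU ▸ hFint)
  rw [← integral_const_mul]
  simp_rw [hI] at hlim1
  exact tendsto_nhds_unique hlim1 hlim2

end

/-! ### The interference exponent and the hypergeometric function -/

section

/-- The substitution `t = x ^ (-β)` in Euler's integral. -/
theorem zOne_eq_integral {β T : ℝ} (hβ : 2 < β) :
    zOne β T = 2 * ∫ x in Set.Ioi (1 : ℝ), x * (T * x ^ (-β) / (1 + T * x ^ (-β))) := by
  have hβ0 : 0 < β := by linarith
  have hb : 0 < 1 - 2 / β := by rw [sub_pos, div_lt_one hβ0]; exact hβ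
  have hG0 := Real.Gamma_pos_of_pos hb
  have h1 : gaussHypergeometric 1 (1 - 2 / β) (2 - 2 / β) (-T)
      = (1 - 2 / β) * ∫ t in (0 : ℝ)..1, t ^ (-(2 / β)) * (1 + T * t)⁻¹ := by
    have e1 : (2 : ℝ) - 2 / β = (1 - 2 / β) + 1 := by ring
    have e2 : (1 : ℝ) - 2 / β - 1 = -(2 / β) := by ring
    unfold gaussHypergeometric
    rw [e1, add_sub_cancel_left, Real.Gamma_add_one hb.ne', e2]
    simp only [sub_self, Real.rpow_zero, mul_one, Real.rpow_neg_one, Real.Gamma_one, neg_mul,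
      sub_neg_eq_add]
    rw [mul_div_cancel_right₀ _ hG0.ne']
  have h2 := integral_comp_rpow_Ioi
    ((Set.Ioo (0 : ℝ) 1).indicator fun t => t ^ (-(2 / β)) * (1 + T * t)⁻¹) (p := -β) (by linarith)
  rw [setIntegral_indicator measurableSet_Ioo, Set.inter_eq_right.2 Set.Ioo_subset_Ioi_self] at h2
  have h3 : ∫ x in Set.Ioi (0 : ℝ), (|-β| * x ^ (-β - 1)) •
      ((Set.Ioo (0 : ℝ) 1).indicator fun t => t ^ (-(2 / β)) * (1 + T * t)⁻¹) (x ^ (-β))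
      = ∫ x in Set.Ioi (0 : ℝ), (Set.Ioi (1 : ℝ)).indicator
        (fun x => β * (x ^ (1 - β) * (1 + T * x ^ (-β))⁻¹)) x := by
    refine setIntegral_congr_fun measurableSet_Ioi fun x (hx : 0 < x) => ?_
    have hiff : x ^ (-β) ∈ Set.Ioo (0 : ℝ) 1 ↔ x ∈ Set.Ioi (1 : ℝ) := by
      constructor
      · intro h
        by_contra hx1
        exact absurd h.2 (not_lt.2 (Real.one_le_rpow_of_pos_of_le_one_of_nonpos hx (not_lt.1 hx1)
          (by linarith)))
      · intro h
        exact ⟨Real.rpow_pos_of_pos hx _, Real.rpow_lt_one_of_one_lt_of_neg h (by linarith)⟩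
    by_cases h : x ∈ Set.Ioi (1 : ℝ)
    · simp only [Set.indicator_of_mem h, Set.indicator_of_mem (hiff.2 h)]
      have e3 : (x ^ (-β)) ^ (-(2 / β)) = x ^ (2 : ℝ) := by
        rw [← Real.rpow_mul hx.le]; congr 1; field_simp
      rw [e3, abs_neg, abs_of_pos hβ0, smul_eq_mul,
        show (1 : ℝ) - β = (-β - 1) + 2 by ring, Real.rpow_add hx]
      ring
    · simp only [Set.indicator_of_notMem h, Set.indicator_of_notMem (fun h' => h (hiff.1 h')),
        smul_zero]
  have hsub : Set.Ioi (1 : ℝ) ⊆ Set.Ioi 0 := Set.Ioi_subset_Ioi zero_le_one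
  rw [h3, setIntegral_indicator measurableSet_Ioi, Set.inter_eq_right.2 hsub,
    integral_const_mul] at h2
  rw [zOne, h1, intervalIntegral.integral_of_le zero_le_one, integral_Ioc_eq_integral_Ioo, ← h2]
  have h4 : ∫ x in Set.Ioi (1 : ℝ), x * (T * x ^ (-β) / (1 + T * x ^ (-β)))
      = T * ∫ x in Set.Ioi (1 : ℝ), x ^ (1 - β) * (1 + T * x ^ (-β))⁻¹ := by
    rw [← integral_const_mul]
    refine setIntegral_congr_fun measurableSet_Ioi fun x hx => ?_
    have hx0 : 0 < x := hsub hx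
    rw [show (1 : ℝ) - β = 1 + -β by ring, Real.rpow_add hx0, Real.rpow_one]
    ring
  rw [h4]
  have : β - 2 ≠ 0 := by linarith
  field_simp

theorem integrableOn_interf {β T : ℝ} (hβ : 2 < β) (hT : 0 ≤ T) :
    IntegrableOn (fun x : ℝ => x * (T * x ^ (-β) / (1 + T * x ^ (-β)))) (Set.Ioi 1) := by
  have h1 : IntegrableOn (fun x : ℝ => T * x ^ (1 - β)) (Set.Ioi 1) :=
    (integrableOn_Ioi_rpow_of_lt (by linarith) one_pos).const_mul T
  refine h1.mono' (by fun_prop) ((ae_restrict_iff' measurableSet_Ioi).2 (ae_of_all _ ?_))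
  intro x (hx : 1 < x)
  have hx0 : 0 < x := one_pos.trans hx
  have h2 := Real.rpow_pos_of_pos hx0 (-β)
  rw [Real.norm_of_nonneg (by positivity), show (1 : ℝ) - β = 1 + -β by ring, Real.rpow_add hx0,
    Real.rpow_one]
  have h3 : T * x ^ (-β) / (1 + T * x ^ (-β)) ≤ T * x ^ (-β) :=
    div_le_self (by positivity) (by linarith [mul_nonneg hT h2.le])
  nlinarith

theorem zOne_nonneg {β T : ℝ} (hβ : 2 < β) (hT : 0 ≤ T) : 0 ≤ zOne β T := by
  rw [zOne_eq_integral hβ]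
  refine mul_nonneg zero_le_two (setIntegral_nonneg measurableSet_Ioi fun x (hx : 1 < x) => ?_)
  have hx0 : 0 < x := one_pos.trans hx
  have h2 := Real.rpow_pos_of_pos hx0 (-β)
  positivity

/-- Polar coordinates outside a disc of radius `a`, in units of `a`. -/
theorem lintegral_outside_disc {q : ℝ → ℝ} (hq0 : ∀ t, 1 < t → 0 ≤ q t)
    (hqi : IntegrableOn (fun x => x * q x) (Set.Ioi 1)) {a : ℝ} (ha : 0 < a) :
    ∫⁻ y in {y : Plane | a < ‖y‖}, ENNReal.ofReal (q (‖y‖ / a))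
      = ENNReal.ofReal (2 * Real.pi * a ^ 2 * ∫ x in Set.Ioi (1 : ℝ), x * q x) := by
  have ha1 : a⁻¹ * a = 1 := inv_mul_cancel₀ ha.ne'
  set f : ℝ → ℝ := (Set.Ioi a).indicator fun ρ => q (ρ / a) with hf
  have hf0 : ∀ y : Plane, 0 ≤ f ‖y‖ := fun y => by
    refine Set.indicator_nonneg (fun ρ (hρ : a < ρ) => ?_) _
    exact hq0 _ ((one_lt_div ha).2 hρ)
  have hdim : Module.finrank ℝ Plane - 1 = 1 := by simp
  have hmeas : MeasurableSet {y : Plane | a < ‖y‖} :=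
    measurableSet_lt measurable_const measurable_norm
  have hsub : Set.Ioi a ⊆ Set.Ioi 0 := Set.Ioi_subset_Ioi ha.le
  have hfun : (fun ρ : ℝ => ρ ^ (Module.finrank ℝ Plane - 1) • f ρ)
      = (Set.Ioi a).indicator fun ρ => a * ((a⁻¹ * ρ) * q (a⁻¹ * ρ)) := by
    ext ρ
    rw [hdim, pow_one, smul_eq_mul, hf]
    by_cases h : ρ ∈ Set.Ioi a
    · simp only [Set.indicator_of_mem h]
      rw [div_eq_inv_mul]
      field_simp
    · simp [Set.indicator_of_notMem h]
  have hint : Integrable (fun y : Plane => f ‖y‖) := by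
    rw [integrable_fun_norm_addHaar, hfun, IntegrableOn, integrable_indicator_iff measurableSet_Ioi,
      IntegrableOn, Measure.restrict_restrict measurableSet_Ioi, Set.inter_eq_left.2 hsub]
    refine Integrable.const_mul ?_ a
    exact (integrableOn_Ioi_comp_mul_left_iff (fun x => x * q x) a (inv_pos.2 ha)).2 (by rwa [ha1])
  have hval : ∫ y : Plane, f ‖y‖ = 2 * Real.pi * a ^ 2 * ∫ x in Set.Ioi (1 : ℝ), x * q x := by
    rw [integral_fun_norm_addHaar, hfun, setIntegral_indicator measurableSet_Ioi,
      Set.inter_eq_right.2 hsub, integral_const_mul,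
      integral_comp_mul_left_Ioi (fun x => x * q x) a (inv_pos.2 ha), ha1, measureReal_def,
      EuclideanSpace.volume_ball_fin_two]
    simp [Real.pi_pos.le]
    ring
  rw [← hval, ofReal_integral_eq_lintegral_ofReal hint (ae_of_all _ hf0),
    ← lintegral_indicator hmeas]
  refine lintegral_congr fun y => ?_
  by_cases h : a < ‖y‖
  · rw [Set.indicator_of_mem (show y ∈ {y : Plane | a < ‖y‖} from h), hf,
      Set.indicator_of_mem (show ‖y‖ ∈ Set.Ioi a from h)]
  · rw [Set.indicator_of_notMem (show y ∉ {y : Plane | a < ‖y‖} from h), hf,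
      Set.indicator_of_notMem (show ‖y‖ ∉ Set.Ioi a from h), ENNReal.ofReal_zero]

namespace Params

variable (N : Params)

theorem one_sub_factor {t : ℝ} (ht : 0 ≤ t) :
    1 - N.factor t = N.pInterf * (N.threshold * t ^ (-N.β) / (1 + N.threshold * t ^ (-N.β))) := by
  have h1 := Real.rpow_nonneg ht (-N.β)
  have h2 := N.threshold_pos
  have h3 : 1 + N.threshold * t ^ (-N.β) ≠ 0 := by positivity
  rw [factor]
  field_simp
  ring

theorem factor_le_one (hp0 : 0 ≤ N.pInterf) {t : ℝ} (ht : 0 ≤ t) : N.factor t ≤ 1 := by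
  have h1 := Real.rpow_nonneg ht (-N.β)
  have h2 := N.threshold_pos
  rw [← sub_nonneg, N.one_sub_factor ht]
  positivity

theorem factor_pos (hp0 : 0 ≤ N.pInterf) (hp1 : N.pInterf ≤ 1) {t : ℝ} (ht : 0 ≤ t) :
    0 < N.factor t := by
  have h1 := Real.rpow_nonneg ht (-N.β)
  have h2 := N.threshold_pos
  rw [factor]
  rcases hp1.lt_or_eq with h | h
  · have : 0 ≤ N.pInterf / (1 + N.threshold * t ^ (-N.β)) := by positivity
    linarith
  · rw [h, sub_self, zero_add]
    positivity

theorem monotoneOn_factor (hp0 : 0 ≤ N.pInterf) : MonotoneOn N.factor (Set.Ici 1) := by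
  intro s hs t ht hst
  have hs0 : 0 < s := one_pos.trans_le hs
  have h1 := Real.rpow_pos_of_pos (hs0.trans_le hst) (-N.β)
  have h2 := N.threshold_pos
  have h3 : t ^ (-N.β) ≤ s ^ (-N.β) :=
    Real.rpow_le_rpow_of_nonpos hs0 hst (by linarith [N.two_lt_β])
  unfold factor
  gcongr

theorem measurable_factor : Measurable N.factor := by
  unfold factor; fun_prop

/-- The interference exponent of the network is `p Z₁(T̄)`, with `p` the probability that a base
station is an interferer. -/
theorem hasExponent (hp0 : 0 ≤ N.pInterf) (hp1 : N.pInterf ≤ 1) :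
    HasExponent N.φb (N.pInterf * zOne N.β N.threshold) fun t => N.factor |t| := by
  intro a ha
  have hT := N.threshold_pos
  have hφ := N.φb_pos
  set q : ℝ → ℝ := fun t =>
    N.pInterf * (N.threshold * t ^ (-N.β) / (1 + N.threshold * t ^ (-N.β))) with hq
  have hcongr : ∀ y : Plane, 1 - ENNReal.ofReal (N.factor |‖y‖ / a|)
      = ENNReal.ofReal (q (‖y‖ / a)) := by
    intro y
    have h0 : 0 ≤ ‖y‖ / a := by positivity
    have hqy : q (‖y‖ / a) = 1 - N.factor (‖y‖ / a) := (N.one_sub_factor h0).symm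
    rw [abs_of_nonneg h0, hqy, ENNReal.ofReal_sub _ (N.factor_pos hp0 hp1 h0).le,
      ENNReal.ofReal_one]
  have hxq : ∀ x, x * q x = N.pInterf *
      (x * (N.threshold * x ^ (-N.β) / (1 + N.threshold * x ^ (-N.β)))) := fun x => by
    simp only [hq]; ring
  simp_rw [hcongr]
  rw [Measure.restrict_smul, lintegral_smul_measure, lintegral_outside_disc _ _ ha, smul_eq_mul,
    ← ENNReal.ofReal_mul hφ.le]
  · congr 1
    simp_rw [hxq]
    rw [integral_const_mul, zOne_eq_integral N.two_lt_β]
    ring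
  · intro t ht
    have h1 := Real.rpow_pos_of_pos (one_pos.trans ht) (-N.β)
    simp only [hq]
    positivity
  · simp_rw [hxq]
    exact (integrableOn_interf N.two_lt_β hT.le).const_mul _

end Params

end

end CacheNet

theorem theorem3 {Ω : Type*} [MeasurableSpace Ω] (μ : Measure Ω) [IsProbabilityMeasure μ]
    (N : CacheNet.Params) (S : CacheNet.BaseStations Ω N) (hS : CacheNet.IsNetwork N μ S) :
    S.lossRate μ =
      1 - 2 * Real.pi * N.φb * ∫ r in Set.Ioi (0 : ℝ),
        r * Real.exp (-(r ^ N.β * N.P⁻¹ * N.threshold * N.noise) -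
          Real.pi * r ^ 2 *
            (N.Pa1 / (N.Pa1 + N.Pa2) * N.φa * CacheNet.zOne N.β N.threshold + N.φb)) := by
  have hP := N.P_pos
  have hT := N.threshold_pos
  have hn := N.noise_pos
  have hφ := N.φb_pos
  have hβ : 0 < N.β := by linarith [N.two_lt_β]
  have hp0 : 0 ≤ N.pInterf := hS.measureReal_kept 0 ▸ measureReal_nonneg
  have hp1 : N.pInterf ≤ 1 := hS.measureReal_kept 0 ▸ measureReal_le_one
  have hX := hS.loc_poisson
  -- Absolute values keep `h` and the factor in the unit interval at negative arguments too.
  set h : ℝ → ℝ := fun t => Real.exp (-(|t| ^ N.β * N.P⁻¹ * N.threshold * N.noise)) with hh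
  set w : ℝ → ℝ := fun t => N.factor |t| with hw
  have hhc : Continuous h := by
    have : Continuous fun t : ℝ => |t| ^ N.β := continuous_abs.rpow_const fun _ => Or.inr hβ.le
    fun_prop
  set κ := N.pInterf * CacheNet.zOne N.β N.threshold with hκ
  have hκ0 : 0 ≤ κ := mul_nonneg hp0 (CacheNet.zOne_nonneg N.two_lt_β hT.le)
  have hcov := CacheNet.lintegral_coverage (h := h) (w := w) hφ hκ0 hX
    (fun t => (Real.exp_pos _).le)
    (fun t => Real.exp_le_one_iff.2 (neg_nonpos.2 (by positivity)))
    (fun s (hs : 0 < s) t (ht : 0 < t) hst => by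
      simp only [hh, abs_of_pos hs, abs_of_pos ht]
      gcongr)
    hhc.measurable hhc.continuousOn
    (N.factor_pos hp0 hp1 (abs_nonneg 1))
    (fun t => N.factor_le_one hp0 (abs_nonneg t))
    (fun s hs t ht hst => by
      have hs0 : 0 < s := one_pos.trans_le hs
      have ht0 : 0 < t := one_pos.trans_le ht
      simp only [hw, abs_of_pos hs0, abs_of_pos ht0]
      exact N.monotoneOn_factor hp0 hs ht hst)
    (N.measurable_factor.comp measurable_norm) (N.hasExponent hp0 hp1)
  have hmc := hS.measure_covered hX.ae_nearestDist_pos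
  have hcm : MeasurableSet
      {ω | CacheNet.Covered N (fun i => S.loc i ω) (fun i => S.gain i ω) (fun i => S.kept i ω)} :=
    ((measurable_pi_lambda _ hX.measurable).prodMk
      ((measurable_pi_lambda _ hS.gain_measurable).prodMk
        (measurable_pi_lambda _ hS.measurable_kept))) (CacheNet.measurableSet_covered N)
  have hloss : {ω | N.τ * N.B * Real.logb 2 (1 + (S.sinr ω).toReal) < N.T}
      = {ω | CacheNet.Covered N (fun i => S.loc i ω) (fun i => S.gain i ω)
        (fun i => S.kept i ω)}ᶜ := by
    ext ω
    exact (CacheNet.loss_iff ω).trans (not_congr (CacheNet.covered_iff_le_sinr ω).symm)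
  have hval : μ {ω | CacheNet.Covered N (fun i => S.loc i ω) (fun i => S.gain i ω)
      (fun i => S.kept i ω)}
      = ∫⁻ ω, CacheNet.coverage h w (fun i => S.loc i ω) ∂μ := by
    rw [hmc]
    refine lintegral_congr fun ω => ?_
    have hd : 0 ≤ CacheNet.nearestDist fun i => S.loc i ω := norm_nonneg _
    simp only [CacheNet.coverage, hh, hw, abs_of_nonneg hd,
      abs_of_nonneg (div_nonneg (norm_nonneg _) hd)]
  rw [CacheNet.BaseStations.lossRate, hloss, probReal_compl_eq_one_sub hcm, measureReal_def,
    hval, hcov,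
    ENNReal.toReal_ofReal]
  · congr 2
    refine setIntegral_congr_fun measurableSet_Ioi fun r (hr : 0 < r) => ?_
    simp only [hh, abs_of_pos hr]
    rw [← Real.exp_add]
    congr 2
    rw [hκ, CacheNet.Params.pInterf, CacheNet.Params.φa]
    ring
  · refine mul_nonneg (by positivity)
      (setIntegral_nonneg measurableSet_Ioi fun r (hr : 0 < r) => ?_)
    simp only [hh]
    positivity
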